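/- Let $D\ge 3$, let $r$ be a prime power and put $q=-r$. Let $\Gamma$ be the dual polar graph ${}^2A_{2D-1}(-q)$: its vertices are the maximal totally isotropic subspaces, equivalently the totally isotropic subspaces of dimension $D$, of a $2D$-dimensional vector space over $\mathbb F_{r^2}$ carrying a nondegenerate Hermitian form (with respect to $a\mapsto a^{r}$), and two of them are adjacent when their intersection has dimension $D-1$. Let $X$ be its vertex set, $\partial$ its path-length distance, $A$ its adjacency matrix, $V=\mathbb C^X$, and fix $x\in X$; the eccentricity of $x$ is $D$. For $0\le i\le D$ let $E_i^*$ be the diagonal matrix with $(y,y)$-entry $1$ if $\partial(x,y)=i$ and $0$ otherwise, and let $L=\sum_{i=1}^{D}E^*_{i-1}AE^*_i$ and $R=\sum_{i=0}^{D-1}E^*_{i+1}AE^*_i$. Definitions. For a connected bipartite graph $G$ and a vertex $x$ of eccentricity $\varepsilon$, a parameter matrix is a tridiagonal complex matrix $U=(e_{ij})_{1\le i,j\le\varepsilon}$ such that (i) $e_{ii}=1$ for all $i$; (ii) $e_{i,i-1}\ne0$ for all $2\le i\le\varepsilon$, or $e_{i-1,i}\neq 0$ for all $2\le i\le\varepsilon$;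 (iii) for all $1\le s\le t\le\varepsilon$ the principal submatrix $(e_{ij})_{s\le i,j\le t}$ is nonsingular. Write $e_i^-=e_{i,i-1}$, $e_i^+=e_{i,i+1}$, $e_1^-=e_\varepsilon^+=0$. A uniform structure of $G$ with respect to $x$ is a pair $(U,f)$ with $U$ a parameter matrix and $f=(f_i)_{i=1}^{\varepsilon}\in\mathbb C^\varepsilon$ such that $e_i^-RL^2+LRL+e_i^+L^2R=f_iL$ holds on $E_i^*V$ for $1\le i\le\varepsilon$, where $L,R,E_i^*$ are formed for $G$ and $x$; it is strongly uniform if moreover $e_i^-\ne0$ for $2\le i\le\varepsilon$ and $e_i^+\ne0$ for $1\le i\le\varepsilon-1$. A connected non-bipartite graph $\Gamma$ supports a (strongly) uniform structure with respect to $x$ if the graph $\Gamma_f$, obtained from $\Gamma$ by deleting all edges $yz$ with $\partial(x,y)=\partial(x,z)$, has one with respect to $x$. Theorem. On $E_i^*V$, for every $1\le i\le D$, $$-\frac{q^4}{q^2+1}RL^2+LRL-\frac{q^{-2}}{q^2+1}L^2R=(-q)^{2D-1}L .$$ Moreover, the tridiagonal $D\times D$ matrix $U$ with $e_{ii}=1$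 $(1\le i\le D)$, $e_{i}^-=-q^4/(q^2+1)$ $(2\le i\le D)$ and $e_{i}^+=-q^{-2}/(q^2+1)$ $(1\le i\le D-1)$ is a parameter matrix (in particular all the principal submatrices $(e_{ij})_{s\le i,j\le t}$, $1\le s\le t\le D$, are nonsingular), and, with $f_i=(-q)^{2D-1}$ for $1\le i\le D$, the graph $\Gamma$ is connected and non-bipartite and supports the strongly uniform structure $(U,f)$ with respect to $x$. -/

import Mathlib

open Matrix

noncomputable section

namespace SimpleGraph

section Terwilliger

variable {X : Type*} [Fintype X]

open scoped Classical in
/-- The `i`-th dual idempotent `E*_i = E*_i(x)`: the diagonal matrix whose `(y,y)`-entry is `1` if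
`∂(x,y) = i` and `0` otherwise. -/
def dualIdempotent (G : SimpleGraph X) (x : X) (i : ℕ) : Matrix X X ℂ :=
  Matrix.diagonal fun y => if G.dist x y = i then 1 else 0

/-- The `i`-th subconstituent `E*_i V` of the standard module `V = ℂ^X`. -/
def subconstituent (G : SimpleGraph X) (x : X) (i : ℕ) : Submodule ℂ (X → ℂ) :=
  LinearMap.range (G.dualIdempotent x i).mulVecLin

open scoped Classical in
/-- The lowering matrix `L = ∑_{i=1}^ε E*_{i-1} A E*_i` with respect to `x`, where `ε` is the
eccentricity of `x` and `A` is the adjacency matrix. -/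
def loweringMatrix (G : SimpleGraph X) (x : X) : Matrix X X ℂ :=
  ∑ i ∈ Finset.Icc 1 (G.eccent x).toNat,
    G.dualIdempotent x (i - 1) * G.adjMatrix ℂ * G.dualIdempotent x i

open scoped Classical in
/-- The raising matrix `R = ∑_{i=0}^{ε-1} E*_{i+1} A E*_i` with respect to `x`. -/
def raisingMatrix (G : SimpleGraph X) (x : X) : Matrix X X ℂ :=
  ∑ i ∈ Finset.range (G.eccent x).toNat,
    G.dualIdempotent x (i + 1) * G.adjMatrix ℂ * G.dualIdempotent x i

/-- The equation `em R L² + L R L + ep L² R = f L` is satisfied on `E*_i V`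
(with respect to the vertex `x` of `G`). -/
def UniformEquationOn (G : SimpleGraph X) (x : X) (i : ℕ) (em ep f : ℂ) : Prop :=
  ∀ v ∈ G.subconstituent x i,
    (em • (G.raisingMatrix x * (G.loweringMatrix x * G.loweringMatrix x))
        + G.loweringMatrix x * G.raisingMatrix x * G.loweringMatrix x
        + ep • (G.loweringMatrix x * G.loweringMatrix x * G.raisingMatrix x)) *ᵥ v
      = (f • G.loweringMatrix x) *ᵥ v

end Terwilliger

/-- The `(i,j)`-entry of an `n × n` matrix with rows and columns numbered `1, …, n`, extended by
`0` when an index is out of range. -/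
def entryFromOne {n : ℕ} (U : Matrix (Fin n) (Fin n) ℂ) (i j : ℕ) : ℂ :=
  if h : (1 ≤ i ∧ i ≤ n) ∧ (1 ≤ j ∧ j ≤ n) then
    U ⟨i - 1, by omega⟩ ⟨j - 1, by omega⟩ else 0

/-- `e⁻_i = e_{i,i-1}` for `2 ≤ i ≤ n`; by the convention of `entryFromOne`, `e⁻_1 = 0`. -/
def eMinus {n : ℕ} (U : Matrix (Fin n) (Fin n) ℂ) (i : ℕ) : ℂ := entryFromOne U i (i - 1)

/-- `e⁺_i = e_{i,i+1}` for `1 ≤ i ≤ n - 1`; by the convention of `entryFromOne`, `e⁺_n = 0`. -/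
def ePlus {n : ℕ} (U : Matrix (Fin n) (Fin n) ℂ) (i : ℕ) : ℂ := entryFromOne U i (i + 1)

/-- Parameter matrices. The row and column number `i ∈ {1, …, n}` corresponds to
`i - 1 : Fin n`. -/
structure IsParameterMatrix {n : ℕ} (U : Matrix (Fin n) (Fin n) ℂ) : Prop where
  /-- `U` is tridiagonal. -/
  tridiagonal : ∀ i j : Fin n, (i : ℕ) + 1 < j ∨ (j : ℕ) + 1 < i → U i j = 0
  /-- The diagonal entries are `1`. -/
  diag : ∀ i : Fin n, U i i = 1
  /-- All subdiagonal entries are nonzero, or all superdiagonal entries are nonzero. -/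
  offDiag : (∀ i, 2 ≤ i → i ≤ n → entryFromOne U i (i - 1) ≠ 0) ∨
    (∀ i, 2 ≤ i → i ≤ n → entryFromOne U (i - 1) i ≠ 0)
  /-- The principal submatrix on rows and columns `s, …, t` is nonsingular whenever `s ≤ t`. -/
  nonsingular : ∀ s t : Fin n, s ≤ t →
    (U.submatrix (Subtype.val : Set.Icc s t → Fin n)
      (Subtype.val : Set.Icc s t → Fin n)).det ≠ 0

variable {X : Type*} [Fintype X]

/-- `(U, f)` is a uniform structure, with respect to the vertex `x`, of the (connected) bipartite
graph `G`. Here `n` is the eccentricity of `x`, and `f i` stands for the `i`-th entry of the vector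
`f` (`1 ≤ i ≤ n`). -/
structure IsUniformStructure (G : SimpleGraph X) (x : X) {n : ℕ}
    (U : Matrix (Fin n) (Fin n) ℂ) (f : Fin n → ℂ) : Prop where
  connected : G.Connected
  bipartite : G.IsBipartite
  eccent_eq : G.eccent x = n
  isParameterMatrix : IsParameterMatrix U
  equation : ∀ i : Fin n,
    G.UniformEquationOn x (i + 1) (eMinus U (i + 1)) (ePlus U (i + 1)) (f i)

/-- A strongly uniform structure: a uniform structure in which all the `e⁻_i` (`2 ≤ i ≤ n`) and all
the `e⁺_i` (`1 ≤ i ≤ n - 1`) are nonzero. -/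
structure IsStronglyUniformStructure (G : SimpleGraph X) (x : X) {n : ℕ}
    (U : Matrix (Fin n) (Fin n) ℂ) (f : Fin n → ℂ) : Prop
    extends IsUniformStructure G x U f where
  eMinus_ne_zero : ∀ i, 2 ≤ i → i ≤ n → eMinus U i ≠ 0
  ePlus_ne_zero : ∀ i, 1 ≤ i → i + 1 ≤ n → ePlus U i ≠ 0

/-- The graph `Γ_f = Γ_f(x)`: delete from `Γ` all the edges `yz` with `∂(x,y) = ∂(x,z)`. -/
def flatDeleted {X : Type*} (G : SimpleGraph X) (x : X) : SimpleGraph X where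
  Adj y z := G.Adj y z ∧ G.dist x y ≠ G.dist x z
  symm := ⟨fun _ _ h => ⟨h.1.symm, h.2.symm⟩⟩
  loopless := ⟨fun _ h => h.2 rfl⟩

/-- The connected non-bipartite graph `G` supports the strongly uniform structure `(U, f)` with
respect to `x`: `(U, f)` is a strongly uniform structure of `G_f(x)`. -/
structure SupportsStronglyUniformWith (G : SimpleGraph X) (x : X) {n : ℕ}
    (U : Matrix (Fin n) (Fin n) ℂ) (f : Fin n → ℂ) : Prop where
  connected : G.Connected
  not_bipartite : ¬ G.IsBipartite
  isStronglyUniform : (G.flatDeleted x).IsStronglyUniformStructure x U f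

end SimpleGraph

section DualPolar

variable {K V : Type*} [Field K] [AddCommGroup V] [Module K V] {σ : K →+* K}

/-- The subspaces of dimension `D` that are totally isotropic for the sesquilinear form `h`. For a
nondegenerate Hermitian form on a space of dimension `2 * D` over a finite field these are exactly
the maximal totally isotropic subspaces. -/
@[ext]
structure IsotropicSubspace (h : V →ₛₗ[σ] V →ₗ[K] K) (D : ℕ) where
  carrier : Submodule K V
  isotropic : ∀ u ∈ carrier, ∀ v ∈ carrier, h u v = 0
  finrank_eq : Module.finrank K carrier = D

instance [Finite K] [FiniteDimensional K V] (h : V →ₛₗ[σ] V →ₗ[K] K) (D : ℕ) :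
    Finite (IsotropicSubspace h D) :=
  haveI : Finite V := Module.finite_of_finite K
  Finite.of_injective (fun W : IsotropicSubspace h D => (W.carrier : Set V))
    fun _ _ hW => IsotropicSubspace.ext (SetLike.coe_injective hW)

instance [Finite K] [FiniteDimensional K V] (h : V →ₛₗ[σ] V →ₗ[K] K) (D : ℕ) :
    Fintype (IsotropicSubspace h D) :=
  Fintype.ofFinite _

/-- The dual polar graph of the form `h`: the vertices are the `D`-dimensional totally isotropic
subspaces, and two of them are adjacent when they meet in a subspace of dimension `D - 1`. For a
nondegenerate Hermitian form `h` on a `2D`-dimensional space over the field with `r ^ 2` elements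
this is the dual polar graph `²A_{2D-1}(r)`. -/
def dualPolarGraph (h : V →ₛₗ[σ] V →ₗ[K] K) (D : ℕ) : SimpleGraph (IsotropicSubspace h D) where
  Adj W W' := Module.finrank K (W.carrier ⊓ W'.carrier : Submodule K V) + 1 = D
  symm := ⟨fun W W' hW => inf_comm W.carrier W'.carrier ▸ hW⟩
  loopless := ⟨fun W hW => by
    rw [inf_idem, W.finrank_eq] at hW
    omega⟩

end DualPolar

/-- The `D × D` tridiagonal matrix with `e_{i,i} = 1`, `e_{i,i-1} = -q⁴/(q²+1)` and
`e_{i,i+1} = -q⁻²/(q²+1)`. -/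
def dualPolarParameterMatrix (q : ℤ) (D : ℕ) : Matrix (Fin D) (Fin D) ℂ :=
  Matrix.of fun i j =>
    if i = j then 1
    else if (i : ℕ) = j + 1 then -((q : ℂ) ^ 4 / ((q : ℂ) ^ 2 + 1))
    else if (j : ℕ) = i + 1 then -((q : ℂ) ^ (-2 : ℤ) / ((q : ℂ) ^ 2 + 1))
    else 0

end

/-! For a vertex `y` put `x.meet y` $= y\cap x$; then $\partial(x,y)=D-\dim(y\cap x)$. A neighbour
$z$ of $y$ one step closer to $x$ is determined by $U=z\cap x$, which may be any subspace of $x$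
covering $y\cap x$: it is $z=(y\cap U^\perp)+U$. So going down from $y$ amounts to moving up in the
subspace lattice of $x$, and only the number of ways back up needs the form. That number rests on
one fact: a totally isotropic subspace of dimension $D-1$ lies in exactly $r+1$ vertices.

Let $L$ be the 0/1 matrix of "one step closer", so that $R=L^{\mathsf T}$. Entries of $LL^{\mathsf
T}$ count common upper neighbours and entries of $L^{\mathsf T}L$ common lower neighbours. If $z\cap
x\ne w\cap x$, the first number is $r^2$ times the second (`card_commonUpper`). If $z\cap x=w\cap x$
and $z\ne w$, there are no common upper neighbours. Hence $LL^{\mathsf T}=\Delta+r^2(L^{\mathsf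
T}L-P)$ with $\Delta$ diagonal and $P$ the part of $L^{\mathsf T}L$ on pairs with equal meet
(`lowerMat_mul_transpose`). A second count gives $LP=\Theta L+r^4PL$ with $\Theta$ diagonal
(`lowerMat_mul_pencilMat`). Multiplying the first identity by $L$ on either side and eliminating $P$
leaves a relation between $RL^2$, $LRL$, $L^2R$ and diagonal multiples of $L$; the explicit values
of $\Delta$ and $\Theta$ make these add up to a scalar (`lowerMat_relation`).

Deleting flat edges changes neither distances from $x$ nor $L$, $R$, so the relation passes to
$\Gamma_f$. The principal submatrices of $U$ are nonsingular because a diagonal conjugation makes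
both off-diagonal entries equal to $-r/(r^2+1)$, of absolute value less than $1/2$. -/

noncomputable section

/-! ### Counting the hyperplanes of one subspace that contain another. -/

section Hyperplanes

variable {K V : Type*} [Field K] [AddCommGroup V] [Module K V]

/-- The subspaces of codimension one in `V` correspond to the points of the dual space. -/
def hyperplaneEquivProjectivization [FiniteDimensional K V] :
    {C : Submodule K V // Module.finrank K C + 1 = Module.finrank K V} ≃
      Projectivization K (Module.Dual K V) :=
  ((Subspace.orderIsoFiniteDimensional (K := K) (V := V)).toEquiv.trans
    OrderDual.ofDual).subtypeEquiv (fun C => by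
      have h := Subspace.finrank_add_finrank_dualAnnihilator_eq C
      change _ ↔ Module.finrank K C.dualAnnihilator = 1
      omega) |>.trans (Projectivization.equivSubmodule K (Module.Dual K V)).symm

theorem natCard_hyperplanes [Finite K] [FiniteDimensional K V] :
    Nat.card {C : Submodule K V // Module.finrank K C + 1 = Module.finrank K V} =
      ∑ k ∈ Finset.range (Module.finrank K V), Nat.card K ^ k := by
  rw [Nat.card_congr hyperplaneEquivProjectivization,
    Projectivization.card_of_finrank K _ Subspace.dual_finrank_eq]

theorem finrank_comap_subtype_of_le {A B : Submodule K V} (hAB : A ≤ B) :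
    Module.finrank K (A.comap B.subtype) = Module.finrank K A :=
  (Submodule.comapSubtypeEquivOfLe hAB).finrank_eq

theorem finrank_comap_mkQ [FiniteDimensional K V] (A : Submodule K V) (C : Submodule K (V ⧸ A)) :
    Module.finrank K (C.comap A.mkQ) = Module.finrank K C + Module.finrank K A := by
  have h1 := Submodule.finrank_quotient_add_finrank (A.comap (C.comap A.mkQ).subtype)
  have hA : A ≤ C.comap A.mkQ := fun a ha => by
    rw [Submodule.mem_comap, Submodule.mkQ_apply, (Submodule.Quotient.mk_eq_zero A).2 ha]
    exact C.zero_mem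
  rw [finrank_comap_subtype_of_le hA] at h1
  rw [← h1]
  congr 1
  let f : (C.comap A.mkQ) →ₗ[K] C := A.mkQ.restrict fun v hv => hv
  have hf : Function.Surjective f := by
    rintro ⟨c, hc⟩
    obtain ⟨v, rfl⟩ := A.mkQ_surjective c
    exact ⟨⟨v, hc⟩, rfl⟩
  have hker : LinearMap.ker f = A.comap (C.comap A.mkQ).subtype := by
    ext v
    simp [f, LinearMap.mem_ker, Subtype.ext_iff, LinearMap.restrict_apply]
  rw [← hker]
  exact (f.quotKerEquivOfSurjective hf).finrank_eq

/-- The hyperplanes of `B` through `A` correspond to the hyperplanes of `B / A`. -/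
def hyperplanesBetweenEquiv [FiniteDimensional K V] {A B : Submodule K V} (hAB : A ≤ B) :
    {C : Submodule K V // A ≤ C ∧ C ≤ B ∧ Module.finrank K C + 1 = Module.finrank K B} ≃
    {C : Submodule K (B ⧸ A.comap B.subtype) //
      Module.finrank K C + 1 = Module.finrank K (B ⧸ A.comap B.subtype)} where
  toFun C := ⟨(C.1.comap B.subtype).map (A.comap B.subtype).mkQ, by
    have h := finrank_comap_mkQ _ ((C.1.comap B.subtype).map (A.comap B.subtype).mkQ)
    have hAC : A.comap B.subtype ≤ C.1.comap B.subtype := Submodule.comap_mono C.2.1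
    rw [Submodule.comap_map_mkQ, sup_eq_right.2 hAC, finrank_comap_subtype_of_le C.2.2.1] at h
    have h2 := Submodule.finrank_quotient_add_finrank (A.comap B.subtype)
    have := C.2.2.2
    omega⟩
  invFun C := ⟨(C.1.comap (A.comap B.subtype).mkQ).map B.subtype, by
    refine ⟨fun a ha => ⟨⟨a, hAB ha⟩, ?_, rfl⟩, Submodule.map_subtype_le _ _, ?_⟩
    · change (A.comap B.subtype).mkQ _ ∈ C.1
      rw [Submodule.mkQ_apply, (Submodule.Quotient.mk_eq_zero _).2 (by exact ha)]
      exact C.1.zero_mem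
    · rw [Submodule.finrank_map_subtype_eq, finrank_comap_mkQ]
      have h2 := Submodule.finrank_quotient_add_finrank (A.comap B.subtype)
      have := C.2
      omega⟩
  left_inv C := by
    have hAC : A.comap B.subtype ≤ C.1.comap B.subtype := Submodule.comap_mono C.2.1
    ext1
    simp only [Submodule.comap_map_mkQ, sup_eq_right.2 hAC, Submodule.map_comap_subtype,
      inf_eq_right.2 C.2.2.1]
  right_inv C := by
    ext1
    simp only [Submodule.comap_map_eq_of_injective B.injective_subtype,
      Submodule.map_comap_eq_of_surjective (Submodule.mkQ_surjective _)]

theorem natCard_hyperplanes_between [Finite K] [FiniteDimensional K V] {A B : Submodule K V}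
    (hAB : A ≤ B) {n : ℕ} (hn : Module.finrank K B = Module.finrank K A + n) :
    Nat.card {C : Submodule K V //
        A ≤ C ∧ C ≤ B ∧ Module.finrank K C + 1 = Module.finrank K B} =
      ∑ k ∈ Finset.range n, Nat.card K ^ k := by
  have h2 := Submodule.finrank_quotient_add_finrank (A.comap B.subtype)
  rw [finrank_comap_subtype_of_le hAB] at h2
  rw [Nat.card_congr (hyperplanesBetweenEquiv hAB), natCard_hyperplanes]
  congr 2
  omega

theorem finrank_inf_add_of_hyperplanes [FiniteDimensional K V] {A B W : Submodule K V}
    (hA : A ≤ W) (hB : B ≤ W) :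
    Module.finrank K A + Module.finrank K B ≤
      Module.finrank K W + Module.finrank K (A ⊓ B : Submodule K V) := by
  have := Submodule.finrank_sup_add_finrank_inf_eq A B
  have := Submodule.finrank_mono (sup_le hA hB)
  omega

theorem sup_span_singleton_eq [FiniteDimensional K V] {C W : Submodule K V}
    (hCW : C ≤ W) (hC : Module.finrank K C + 1 = Module.finrank K W) {v : V} (hv : v ∈ W) (hvC : v ∉ C) :
    C ⊔ (K ∙ v) = W := by
  refine Submodule.eq_of_le_of_finrank_le
    (sup_le hCW ((Submodule.span_singleton_le_iff_mem v W).2 hv)) ?_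
  have hlt : C < C ⊔ (K ∙ v) := lt_of_le_of_ne le_sup_left fun he =>
    hvC (he ▸ Submodule.mem_sup_right (Submodule.mem_span_singleton_self v))
  have := Submodule.finrank_lt_finrank_of_lt hlt
  omega

end Hyperplanes

/-! ### The trace map from the field with `r ^ 2` elements to its fixed field. -/

section Trace

open Polynomial

/-- In a field with `r ^ 2` elements, the trace equation `t + t ^ r = s` has `r` solutions
whenever `s ^ r = s`. -/
theorem natCard_trace_fiber {K : Type*} [Field K] [Finite K] {r : ℕ} (hK : Nat.card K = r ^ 2)
    (σ : K →+* K) (hσ : ∀ a, σ a = a ^ r) {s : K} (hs : σ s = s) :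
    Nat.card {t : K // t + σ t = s} = r := by
  classical
  have : Fintype K := Fintype.ofFinite K
  have hr : 1 < r := by
    have : 1 < Nat.card K := Finite.one_lt_card
    rw [hK] at this
    by_contra h
    interval_cases r <;> simp at this
  have hσσ : ∀ a, σ (σ a) = a := fun a => by
    rw [hσ, hσ, ← pow_mul, ← sq, ← hK, Nat.card_eq_fintype_card, FiniteField.pow_card]
  let T : K →+ K := AddMonoidHom.id K + σ.toAddMonoidHom
  have hT : ∀ a, T a = a + σ a := fun a => rfl
  -- Kernel and image of the trace `T` consist of roots of $X^r+X$ and $X^r-X$ respectively, so each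
  -- has at most $r$ elements. Their orders multiply to $r^2$, hence both equal $r$ and the image is
  -- the whole fixed field.
  have bound : ∀ c : K, c ≠ 0 → Nat.card {t : K // t ^ r = c * t} ≤ r := fun c hc => by
    have hdeg : (X ^ r - C c * X : K[X]).natDegree = r := by
      rw [Polynomial.natDegree_sub_eq_left_of_natDegree_lt] <;>
        simp [hc, hr]
    have hne : (X ^ r - C c * X : K[X]) ≠ 0 := by
      intro h0
      rw [h0] at hdeg
      simp at hdeg
      omega
    have h1 := Polynomial.card_roots' (X ^ r - C c * X : K[X])
    rw [hdeg] at h1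
    refine le_trans ?_ (le_trans (Multiset.toFinset_card_le _) h1)
    rw [Nat.card_eq_fintype_card, Fintype.card_subtype]
    refine Finset.card_le_card fun t ht => ?_
    simpa [hne, sub_eq_zero] using ht
  have hker : Nat.card T.ker ≤ r := by
    refine le_trans (le_of_eq (Nat.card_congr (Equiv.subtypeEquivRight fun t => ?_)))
      (bound (-1) (by simp))
    rw [AddMonoidHom.mem_ker, hT, hσ, neg_one_mul, eq_neg_iff_add_eq_zero, add_comm]
  have hfix : Nat.card {t : K // t ^ r = 1 * t} ≤ r := bound 1 one_ne_zero
  have hle : (T.range : Set K) ⊆ {t : K | t ^ r = 1 * t} := by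
    rintro _ ⟨t, rfl⟩
    change (T t) ^ r = _
    rw [← hσ, hT, map_add, hσσ, one_mul, add_comm]
  have hrange : Nat.card T.range ≤ Nat.card {t : K // t ^ r = 1 * t} :=
    Nat.card_mono (Set.toFinite _) hle
  have hmul : Nat.card T.ker * Nat.card T.range = r ^ 2 := by
    rw [← hK, ← AddSubgroup.card_mul_index T.ker, AddSubgroup.index_ker]
  have hkr : Nat.card T.ker = r := by nlinarith
  have hrr : Nat.card T.range = r := by
    rw [hkr] at hmul
    nlinarith
  have heq : (T.range : Set K) = {t : K | t ^ r = 1 * t} :=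
    Set.eq_of_subset_of_ncard_le hle (by
      change Nat.card {t : K // t ^ r = 1 * t} ≤ Nat.card T.range
      omega) (Set.toFinite _)
  obtain ⟨t₀, ht₀⟩ : s ∈ (T.range : Set K) := by
    rw [heq]
    simp [← hσ, hs]
  rw [← hkr]
  refine Nat.card_congr ⟨fun t => ⟨t.1 - t₀, ?_⟩, fun t => ⟨t.1 + t₀, ?_⟩, fun t => ?_, fun t => ?_⟩
  · rw [AddMonoidHom.mem_ker, map_sub, ht₀, hT, t.2, sub_self]
  · rw [← hT, map_add, ht₀, (AddMonoidHom.mem_ker).1 t.2, zero_add]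
  · simp
  · simp

end Trace

/-! ### Orthogonal complements for a finite Hermitian form. -/

/-- A nondegenerate Hermitian form on a space of dimension `2 * D` over a field with `r ^ 2`
elements. -/
structure IsFiniteHermitian {K V : Type*} [Field K] [AddCommGroup V] [Module K V] {σ : K →+* K}
    (h : V →ₛₗ[σ] V →ₗ[K] K) (D r : ℕ) : Prop where
  card_eq : Nat.card K = r ^ 2
  finrank_eq : Module.finrank K V = 2 * D
  conj : ∀ a : K, σ a = a ^ r
  herm : ∀ u v : V, h v u = σ (h u v)
  nondegenerate : h.Nondegenerate

namespace IsFiniteHermitian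

variable {K V : Type*} [Field K] [AddCommGroup V] [Module K V]
  {σ : K →+* K} {h : V →ₛₗ[σ] V →ₗ[K] K} {D r : ℕ}

theorem conj_conj [Finite K] (H : IsFiniteHermitian h D r) (a : K) : σ (σ a) = a := by
  have : Fintype K := Fintype.ofFinite K
  rw [H.conj, H.conj, ← pow_mul, ← sq, ← H.card_eq, Nat.card_eq_fintype_card, FiniteField.pow_card]

theorem one_lt [Finite K] (H : IsFiniteHermitian h D r) : 1 < r := by
  have : 1 < Nat.card K := Finite.one_lt_card
  rw [H.card_eq] at this
  by_contra h
  interval_cases r <;> simp at this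

theorem ortho_comm (H : IsFiniteHermitian h D r) {u v : V} (huv : h u v = 0) : h v u = 0 := by
  rw [H.herm, huv, map_zero]

theorem finrank_add_finrank_orthogonal [Finite K] [FiniteDimensional K V]
    (H : IsFiniteHermitian h D r) (W : Submodule K V) :
    Module.finrank K W + Module.finrank K (W.orthogonalBilin h) = 2 * D := by
  have : RingHomSurjective σ := ⟨fun a => ⟨σ a, H.conj_conj a⟩⟩
  have hinj : Function.Injective h := by
    refine (injective_iff_map_eq_zero h).2 fun u hu => H.nondegenerate.1 u fun v => ?_
    rw [hu, LinearMap.zero_apply]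
  have hco : (W.map h).dualCoannihilator = W.orthogonalBilin h := by
    ext v
    simp [Submodule.mem_dualCoannihilator, Submodule.mem_orthogonalBilin_iff]
  -- The form is only semilinear in its first argument, so the dimension of the image of `W` is read
  -- off from its cardinality.
  have hcard : Nat.card (W.map h) = Nat.card W := by
    rw [← SetLike.coe_sort_coe, Submodule.map_coe, Nat.card_image_of_injective hinj]
    rfl
  have hfin : Module.finrank K (W.map h) = Module.finrank K W := by
    rw [Module.natCard_eq_pow_finrank (K := K) (V := W.map h),
      Module.natCard_eq_pow_finrank (K := K) (V := W)] at hcard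
    exact Nat.pow_right_injective Finite.one_lt_card hcard
  rw [← H.finrank_eq, ← hfin, ← hco]
  exact Subspace.finrank_add_finrank_dualCoannihilator_eq _

end IsFiniteHermitian

/-! ### Lower neighbours and their intersections with `x`. -/

namespace IsotropicSubspace

variable {K V : Type*} [Field K] [AddCommGroup V] [Module K V]
  {σ : K →+* K} {h : V →ₛₗ[σ] V →ₗ[K] K} {D r : ℕ}

/-- The intersection of a vertex `y` with the base vertex `x`. -/
def meet (x y : IsotropicSubspace h D) : Submodule K V := y.carrier ⊓ x.carrier

theorem meet_le_left (x y : IsotropicSubspace h D) : x.meet y ≤ y.carrier := inf_le_left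

theorem meet_le_right (x y : IsotropicSubspace h D) : x.meet y ≤ x.carrier := inf_le_right

theorem meet_self (x : IsotropicSubspace h D) : x.meet x = x.carrier := inf_idem _

/-- `x.IsLower z y` says that `z` is a neighbour of `y` in the dual polar graph which is one step
closer to `x`. -/
def IsLower (x z y : IsotropicSubspace h D) : Prop :=
  (dualPolarGraph h D).Adj z y ∧
    Module.finrank K (x.meet z) = Module.finrank K (x.meet y) + 1

theorem finrank_adj {z y : IsotropicSubspace h D} (hzy : (dualPolarGraph h D).Adj z y) :
    Module.finrank K (z.carrier ⊓ y.carrier : Submodule K V) + 1 = D := hzy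

theorem le_orthogonal (y : IsotropicSubspace h D) {W : Submodule K V} (hW : W ≤ y.carrier) :
    y.carrier ≤ W.orthogonalBilin h :=
  fun v hv u hu => y.isotropic u (hW hu) v hv

variable [FiniteDimensional K V]

theorem eq_of_carrier_le {y z : IsotropicSubspace h D} (hyz : y.carrier ≤ z.carrier) : y = z :=
  IsotropicSubspace.ext (Submodule.eq_of_le_of_finrank_eq hyz (y.finrank_eq.trans z.finrank_eq.symm))

/-- Two distinct vertices containing a common `(D-1)`-dimensional subspace `C` are adjacent and
meet in `C`. -/
theorem inf_eq_of_le {y z : IsotropicSubspace h D} (hyz : y ≠ z) {C : Submodule K V}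
    (hC : Module.finrank K C + 1 = D) (hy : C ≤ y.carrier) (hz : C ≤ z.carrier) :
    z.carrier ⊓ y.carrier = C := by
  refine (Submodule.eq_of_le_of_finrank_le (le_inf hz hy) ?_).symm
  have hlt : z.carrier ⊓ y.carrier < y.carrier := by
    refine lt_of_le_of_ne inf_le_right fun he => hyz (eq_of_carrier_le ?_)
    rw [← he]
    exact inf_le_left
  have := Submodule.finrank_lt_finrank_of_lt hlt
  have := y.finrank_eq
  omega

theorem adj_of_le {y z : IsotropicSubspace h D} (hyz : y ≠ z) {C : Submodule K V}
    (hC : Module.finrank K C + 1 = D) (hy : C ≤ y.carrier) (hz : C ≤ z.carrier) :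
    (dualPolarGraph h D).Adj z y := by
  change Module.finrank K (z.carrier ⊓ y.carrier : Submodule K V) + 1 = D
  rw [inf_eq_of_le hyz hC hy hz, hC]

variable {x y z w p : IsotropicSubspace h D}

theorem finrank_meet_le_of_adj (hzy : (dualPolarGraph h D).Adj z y) :
    Module.finrank K (x.meet z) ≤ Module.finrank K (x.meet y) + 1 := by
  have h1 := finrank_inf_add_of_hyperplanes (x.meet_le_left z)
    (inf_le_left : z.carrier ⊓ y.carrier ≤ z.carrier)
  have h2 : x.meet z ⊓ (z.carrier ⊓ y.carrier) ≤ x.meet y :=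
    le_inf (inf_le_right.trans inf_le_right) (inf_le_left.trans (x.meet_le_right z))
  have := Submodule.finrank_mono h2
  have := z.finrank_eq
  have := finrank_adj hzy
  omega

/-- Inside $z$, the hyperplane $z\cap y$ cuts $z\cap x$ in codimension at most one, and the result
lies in $y\cap x$. The dimensions force equality. -/
theorem IsLower.meet_le (hzy : x.IsLower z y) : x.meet y ≤ x.meet z := by
  have h1 := finrank_inf_add_of_hyperplanes (x.meet_le_left z)
    (inf_le_left : z.carrier ⊓ y.carrier ≤ z.carrier)
  have h2 : x.meet z ⊓ (z.carrier ⊓ y.carrier) ≤ x.meet y :=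
    le_inf (inf_le_right.trans inf_le_right) (inf_le_left.trans (x.meet_le_right z))
  have h3 := z.finrank_eq
  have h4 := finrank_adj hzy.1
  have h5 := hzy.2
  rw [← Submodule.eq_of_le_of_finrank_le h2 (by omega)]
  exact inf_le_left

theorem IsLower.not_meet_le (hzy : x.IsLower z y) : ¬ x.meet z ≤ y.carrier := fun hle => by
  have := Submodule.finrank_mono (show x.meet z ≤ x.meet y from le_inf hle (x.meet_le_right z))
  have := hzy.2
  omega

theorem IsLower.inf_sup_meet (hzy : x.IsLower z y) :
    (z.carrier ⊓ y.carrier) ⊔ x.meet z = z.carrier := by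
  refine Submodule.eq_of_le_of_finrank_le (sup_le inf_le_left (x.meet_le_left z)) ?_
  have hlt : z.carrier ⊓ y.carrier < (z.carrier ⊓ y.carrier) ⊔ x.meet z :=
    lt_of_le_of_ne le_sup_left fun he =>
      hzy.not_meet_le ((le_sup_right.trans he.symm.le).trans inf_le_right)
  have := Submodule.finrank_lt_finrank_of_lt hlt
  have := z.finrank_eq
  have := finrank_adj hzy.1
  omega

theorem finrank_meet_sup (hzy : x.IsLower z y) (hwy : x.IsLower w y)
    (hzw : x.meet z ≠ x.meet w) :
    x.meet z ⊓ x.meet w = x.meet y ∧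
    Module.finrank K (x.meet z ⊔ x.meet w : Submodule K V) =
      Module.finrank K (x.meet z) + 1 := by
  have h1 := Submodule.finrank_sup_add_finrank_inf_eq (x.meet z) (x.meet w)
  have hlt : x.meet z ⊓ x.meet w < x.meet z := by
    refine lt_of_le_of_ne inf_le_left fun he => hzw ?_
    refine Submodule.eq_of_le_of_finrank_eq (he ▸ inf_le_right) ?_
    rw [hzy.2, hwy.2]
  have h2 := Submodule.finrank_lt_finrank_of_lt hlt
  have h3 := hzy.2
  have h4 := hwy.2
  have h5 : x.meet y = x.meet z ⊓ x.meet w :=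
    Submodule.eq_of_le_of_finrank_le (le_inf hzy.meet_le hwy.meet_le) (by omega)
  rw [← h5] at h1 ⊢
  exact ⟨rfl, by omega⟩

/-- A common lower neighbour of two vertices meets `x` in the sum of their intersections
with `x`. -/
theorem IsLower.meet_eq_sup (hpz : x.IsLower p z) (hpw : x.IsLower p w)
    (hzw : x.meet z ≠ x.meet w) : x.meet p = x.meet z ⊔ x.meet w := by
  refine (Submodule.eq_of_le_of_finrank_le (sup_le hpz.meet_le hpw.meet_le) ?_).symm
  have h1 := hpz.2
  have h2 := hpw.2
  have hlt : x.meet z < x.meet z ⊔ x.meet w := by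
    refine lt_of_le_of_ne le_sup_left fun he => hzw ?_
    refine (Submodule.eq_of_le_of_finrank_eq (he ▸ le_sup_right) (by omega)).symm
  have := Submodule.finrank_lt_finrank_of_lt hlt
  omega

theorem IsLower.finrank_meet_inf (hpz : x.IsLower p z) (hpw : x.IsLower p w)
    (hzw : x.meet z ≠ x.meet w) :
    Module.finrank K (x.meet z ⊓ x.meet w : Submodule K V) + 1 = Module.finrank K (x.meet z) := by
  have h1 := Submodule.finrank_sup_add_finrank_inf_eq (x.meet z) (x.meet w)
  rw [← hpz.meet_eq_sup hpw hzw] at h1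
  have h2 := hpz.2
  have h3 := hpw.2
  omega

variable [Finite K]

theorem orthogonal_eq (H : IsFiniteHermitian h D r) (y : IsotropicSubspace h D) :
    y.carrier.orthogonalBilin h = y.carrier := by
  refine (Submodule.eq_of_le_of_finrank_eq (y.le_orthogonal le_rfl) ?_).symm
  have := H.finrank_add_finrank_orthogonal y.carrier
  have := y.finrank_eq
  omega

theorem le_of_le_orthogonal (H : IsFiniteHermitian h D r) (y : IsotropicSubspace h D)
    {W : Submodule K V} (hW : W ≤ y.carrier.orthogonalBilin h) : W ≤ y.carrier :=
  (y.orthogonal_eq H) ▸ hW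

theorem le_of_carrier_le_orthogonal (H : IsFiniteHermitian h D r) (y : IsotropicSubspace h D)
    {W : Submodule K V} (hW : y.carrier ≤ W.orthogonalBilin h) : W ≤ y.carrier :=
  y.le_of_le_orthogonal H fun _ hw _ hv => H.ortho_comm (hW hv _ hw)

/-- The right side depends on $z$ only through $z\cap x$. It is a proper subspace of $y$, since
otherwise $z\cap x\le y^\perp=y$; as it contains the hyperplane $z\cap y$, the two agree. -/
theorem IsLower.inf_eq (H : IsFiniteHermitian h D r) (hzy : x.IsLower z y) :
    z.carrier ⊓ y.carrier = y.carrier ⊓ (x.meet z).orthogonalBilin h := by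
  refine Submodule.eq_of_le_of_finrank_le
    (le_inf inf_le_right (inf_le_left.trans (z.le_orthogonal (x.meet_le_left z)))) ?_
  have hlt : y.carrier ⊓ (x.meet z).orthogonalBilin h < y.carrier :=
    lt_of_le_of_ne inf_le_left fun he => hzy.not_meet_le
      (y.le_of_carrier_le_orthogonal H (he ▸ inf_le_right))
  have := Submodule.finrank_lt_finrank_of_lt hlt
  have := y.finrank_eq
  have := finrank_adj hzy.1
  omega

theorem IsLower.carrier_eq (H : IsFiniteHermitian h D r) (hzy : x.IsLower z y) :
    z.carrier = (y.carrier ⊓ (x.meet z).orthogonalBilin h) ⊔ x.meet z := by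
  rw [← hzy.inf_eq H, hzy.inf_sup_meet]

/-- A lower neighbour is determined by its intersection with `x`. -/
theorem IsLower.unique (H : IsFiniteHermitian h D r) (hzy : x.IsLower z y) (hwy : x.IsLower w y)
    (hzw : x.meet z = x.meet w) : z = w :=
  IsotropicSubspace.ext (by rw [hzy.carrier_eq H, hwy.carrier_eq H, hzw])

/-- For every subspace `U` of `x` covering `y ∩ x` there is a lower neighbour of `y` meeting `x`
in `U`. -/
theorem exists_isLower (H : IsFiniteHermitian h D r) (x y : IsotropicSubspace h D)
    {U : Submodule K V} (hUx : U ≤ x.carrier) (hyU : x.meet y ≤ U)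
    (hU : Module.finrank K U = Module.finrank K (x.meet y) + 1) :
    ∃ z, x.IsLower z y ∧ x.meet z = U := by
  set A := y.carrier ⊓ U.orthogonalBilin h with hA
  obtain ⟨v, hvU, hvy⟩ : ∃ v ∈ U, v ∉ x.meet y := by
    by_contra! hcon
    have := Submodule.finrank_mono (show U ≤ x.meet y from hcon)
    omega
  have hspan : x.meet y ⊔ (K ∙ v) = U := sup_span_singleton_eq hyU hU.symm hvU hvy
  -- Since $U=(y\cap x)+\langle v\rangle$ and $y$ is orthogonal to $y\cap x$, orthogonality to $U$
  -- is a single linear condition on $y$. Hence $A$ has codimension at most one.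
  have hker : y.carrier ⊓ LinearMap.ker (h v) ≤ A := by
    refine le_inf inf_le_left fun a ha u hu => ?_
    rw [← hspan] at hu
    obtain ⟨s, hs, t, ht, rfl⟩ := Submodule.mem_sup.1 hu
    obtain ⟨c, rfl⟩ := Submodule.mem_span_singleton.1 ht
    rw [map_add, LinearMap.add_apply, y.isotropic s (x.meet_le_left y hs) a ha.1, map_smulₛₗ,
      LinearMap.smul_apply, LinearMap.mem_ker.1 ha.2, smul_zero, add_zero]
  have hkerdim : D ≤ Module.finrank K (y.carrier ⊓ LinearMap.ker (h v) : Submodule K V) + 1 := by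
    have h1 := finrank_inf_add_of_hyperplanes (le_top : y.carrier ≤ ⊤)
      (le_top : LinearMap.ker (h v) ≤ ⊤)
    have h2 := (h v).finrank_range_add_finrank_ker
    have h3 := Submodule.finrank_le (LinearMap.range (h v))
    rw [Module.finrank_self] at h3
    rw [finrank_top] at h1
    have := y.finrank_eq
    omega
  have hAU : A ⊓ U ≤ x.meet y := le_inf (inf_le_left.trans inf_le_left) (inf_le_right.trans hUx)
  have hUU : U ≤ U.orthogonalBilin h := fun a ha b hb => x.isotropic b (hUx hb) a (hUx ha)
  have hiso : ∀ a ∈ A ⊔ U, ∀ b ∈ A ⊔ U, h a b = 0 := by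
    intro a ha b hb
    obtain ⟨a₁, ha₁, a₂, ha₂, rfl⟩ := Submodule.mem_sup.1 ha
    obtain ⟨b₁, hb₁, b₂, hb₂, rfl⟩ := Submodule.mem_sup.1 hb
    simp [y.isotropic a₁ ha₁.1 b₁ hb₁.1, hb₁.2 a₂ ha₂, H.ortho_comm (ha₁.2 b₂ hb₂), hUU hb₂ a₂ ha₂]
  have hAlt : A < y.carrier := by
    refine lt_of_le_of_ne inf_le_left fun he => hvy ⟨?_, hUx hvU⟩
    exact y.le_of_carrier_le_orthogonal H (he ▸ inf_le_right) hvU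
  have hAdim : Module.finrank K A + 1 = D := by
    have h1 := Submodule.finrank_mono hker
    have h2 := Submodule.finrank_lt_finrank_of_lt hAlt
    have h3 := y.finrank_eq
    omega
  have hyA : x.meet y ≤ A :=
    le_inf inf_le_left fun a ha b hb => x.isotropic b (hUx hb) a (x.meet_le_right y ha)
  have hAUeq : A ⊓ U = x.meet y := le_antisymm hAU (le_inf hyA hyU)
  have hdim : Module.finrank K (A ⊔ U : Submodule K V) = D := by
    have h1 := Submodule.finrank_sup_add_finrank_inf_eq A U
    rw [hAUeq] at h1
    omega
  have hmeet : (A ⊔ U) ⊓ x.carrier = U := by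
    rw [sup_comm, sup_inf_assoc_of_le A hUx, sup_eq_left]
    exact (inf_le_inf_right _ inf_le_left).trans hyU
  refine ⟨⟨A ⊔ U, hiso, hdim⟩, ⟨adj_of_le (C := A) ?_ hAdim hAlt.le le_sup_left, ?_⟩, hmeet⟩
  · intro he
    have hcar : y.carrier = A ⊔ U := congrArg carrier he
    exact hvy ⟨hcar ▸ Submodule.mem_sup_right hvU, hUx hvU⟩
  · change Module.finrank K ((A ⊔ U) ⊓ x.carrier : Submodule K V) = _
    rw [hmeet, hU]

/-- Lowering in two steps does not depend on the intermediate subspace of `x`. -/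
theorem IsLower.exchange (H : IsFiniteHermitian h D r) (hzy : x.IsLower z y)
    (hpz : x.IsLower p z) (hwy : x.IsLower w y) (hwp : x.meet w ≤ x.meet p) :
    x.IsLower p w := by
  have hdw := hwy.2
  have hdz := hzy.2
  have hdp := hpz.2
  obtain ⟨p', hp'w, hp'⟩ := exists_isLower H x w (x.meet_le_right p) hwp (by omega)
  suffices p = p' from this ▸ hp'w
  -- Both `p` and the vertex `p'` below `w` equal $B+(p\cap x)$, an expression in which neither `z`
  -- nor `w` occurs.
  set B := y.carrier ⊓ (x.meet p).orthogonalBilin h with hB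
  have key : ∀ z p : IsotropicSubspace h D, x.IsLower z y → x.IsLower p z →
      B = y.carrier ⊓ (x.meet p).orthogonalBilin h → B ≤ p.carrier := by
    intro z p hzy hpz hB
    have hBz : B ≤ z.carrier := by
      rw [hB]
      refine le_trans (le_inf inf_le_left (inf_le_right.trans ?_)) ((hzy.inf_eq H).symm.le.trans
        inf_le_left)
      exact Submodule.orthogonalBilin_le hpz.meet_le
    refine le_trans (le_inf hBz ?_) ((hpz.inf_eq H).symm.le.trans inf_le_left)
    rw [hB]
    exact inf_le_right
  have h1 := key z p hzy hpz hB
  have h2 := key w p' hwy hp'w (by rw [hp'])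
  have h3 : B ⊔ x.meet p ≤ p.carrier := sup_le h1 (x.meet_le_left p)
  have h4 : B ⊔ x.meet p ≤ p'.carrier := sup_le h2 (hp' ▸ x.meet_le_left p')
  -- Two hyperplanes of $z$ meet inside $B$, so $\dim B\ge D-2$, while $B\cap(p\cap x)\le y\cap x$
  -- and $\dim(p\cap x)=\dim(y\cap x)+2$.
  have h5 : Module.finrank K p.carrier ≤ Module.finrank K (B ⊔ x.meet p : Submodule K V) := by
    have h6 := Submodule.finrank_sup_add_finrank_inf_eq B (x.meet p)
    have h7 : B ⊓ x.meet p ≤ x.meet y :=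
      le_inf (inf_le_left.trans inf_le_left) (inf_le_right.trans (x.meet_le_right p))
    have h8 := Submodule.finrank_mono h7
    have h9 := finrank_inf_add_of_hyperplanes
      (inf_le_left : z.carrier ⊓ y.carrier ≤ z.carrier)
      (inf_le_right : p.carrier ⊓ z.carrier ≤ z.carrier)
    have h10 : (z.carrier ⊓ y.carrier) ⊓ (p.carrier ⊓ z.carrier) ≤ B := by
      refine le_inf (inf_le_left.trans inf_le_right) ?_
      rw [hpz.inf_eq H]
      exact inf_le_right.trans inf_le_right
    have h11 := Submodule.finrank_mono h10
    have := finrank_adj hzy.1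
    have := finrank_adj hpz.1
    have := z.finrank_eq
    have := p.finrank_eq
    omega
  exact eq_of_carrier_le ((Submodule.eq_of_le_of_finrank_le h3 h5).symm.le.trans h4)

/-- Two lower neighbours of `y` with different intersections with `x` have a common lower
neighbour. -/
theorem IsLower.exists_common (H : IsFiniteHermitian h D r) (hzy : x.IsLower z y)
    (hwy : x.IsLower w y) (hzw : x.meet z ≠ x.meet w) :
    ∃ p, x.IsLower p z ∧ x.IsLower p w := by
  obtain ⟨p, hpz, hp⟩ := exists_isLower H x z
    (sup_le (x.meet_le_right z) (x.meet_le_right w)) le_sup_left (finrank_meet_sup hzy hwy hzw).2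
  exact ⟨p, hpz, hzy.exchange H hpz hwy (hp ▸ le_sup_right)⟩

theorem IsLower.common_unique (H : IsFiniteHermitian h D r) {p' : IsotropicSubspace h D}
    (hpz : x.IsLower p z) (hpw : x.IsLower p w) (hpz' : x.IsLower p' z) (hpw' : x.IsLower p' w)
    (hzw : x.meet z ≠ x.meet w) : p = p' :=
  hpz.unique H hpz' (by rw [hpz.meet_eq_sup hpw hzw, hpz'.meet_eq_sup hpw' hzw])

end IsotropicSubspace

/-! ### The vertices through a totally isotropic subspace of dimension `D - 1`. -/

namespace IsotropicSubspace

variable {K V : Type*} [Field K] [AddCommGroup V] [Module K V]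
  {σ : K →+* K} {h : V →ₛₗ[σ] V →ₗ[K] K} {D r : ℕ}
  [Finite K] [FiniteDimensional K V] {x y z w p : IsotropicSubspace h D}

/-- Through a `(D-1)`-dimensional totally isotropic subspace there are `r` vertices besides
a given one. -/
theorem natCard_line (H : IsFiniteHermitian h D r) (z : IsotropicSubspace h D)
    {C : Submodule K V} (hCz : C ≤ z.carrier) (hC : Module.finrank K C + 1 = D) :
    Nat.card {y : IsotropicSubspace h D // C ≤ y.carrier ∧ y ≠ z} = r := by
  have hz := z.finrank_eq
  have hperp := H.finrank_add_finrank_orthogonal C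
  obtain ⟨u₀, hu₀z, hu₀C⟩ : ∃ u ∈ z.carrier, u ∉ C := by
    by_contra! hcon
    have := Submodule.finrank_mono (show z.carrier ≤ C from hcon)
    omega
  obtain ⟨v, hvC, hvz⟩ : ∃ v ∈ C.orthogonalBilin h, v ∉ z.carrier := by
    by_contra! hcon
    have := Submodule.finrank_mono (show C.orthogonalBilin h ≤ z.carrier from hcon)
    omega
  have hspan₀ := sup_span_singleton_eq hCz (by omega) hu₀z hu₀C
  have hc : h v u₀ ≠ 0 := fun h0 => hvz <| by
    rw [← z.orthogonal_eq H]
    intro a ha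
    rw [← hspan₀] at ha
    obtain ⟨s, hs, t, ht, rfl⟩ := Submodule.mem_sup.1 ha
    obtain ⟨c, rfl⟩ := Submodule.mem_span_singleton.1 ht
    simp [hvC s hs, H.ortho_comm h0]
  -- With $u\in z\setminus C$ and $v\in C^\perp\setminus z$ scaled so that $h(v,u)=1$, one has
  -- $C^\perp=C+\langle u,v\rangle$. The vertices through $C$ other than $z$ are the $C+\langle
  -- v+tu\rangle$ with $v+tu$ isotropic, that is $t+t^r=-h(v,v)$; the trace equation then gives the
  -- count.
  obtain ⟨u, huz, huC, hvu⟩ : ∃ u ∈ z.carrier, u ∉ C ∧ h v u = 1 := by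
    refine ⟨(h v u₀)⁻¹ • u₀, z.carrier.smul_mem _ hu₀z, fun hmem => hu₀C ?_, by simp [hc]⟩
    exact (C.smul_mem_iff (inv_ne_zero hc)).1 hmem
  have huv : h u v = 1 := by rw [H.herm, hvu, map_one]
  have huu : h u u = 0 := z.isotropic u huz u huz
  have hspan := sup_span_singleton_eq hCz (by omega) huz huC
  have hspan' : z.carrier ⊔ (K ∙ v) = C.orthogonalBilin h :=
    sup_span_singleton_eq (z.le_orthogonal hCz) (by omega) hvC hvz
  have hself : ∀ t : K, h (v + t • u) (v + t • u) = h v v + (t + σ t) := fun t => by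
    simp only [map_add, LinearMap.add_apply, map_smul, map_smulₛₗ, LinearMap.smul_apply,
      smul_eq_mul, hvu, huv, huu]
    ring
  have hnotz : ∀ t : K, v + t • u ∉ z.carrier := fun t hmem =>
    hvz ((Submodule.add_mem_iff_left _ (z.carrier.smul_mem t huz)).1 hmem)
  have hperpC : ∀ (t : K), ∀ c ∈ C, h c (v + t • u) = 0 := fun t c hc => by
    rw [map_add, map_smul, hvC c hc, z.isotropic c (hCz hc) u huz, smul_zero, add_zero]
  have hs : σ (-h v v) = -h v v := by rw [map_neg, ← H.herm]
  rw [← natCard_trace_fiber H.card_eq σ H.conj hs]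
  have hiso : ∀ t : K, t + σ t = -h v v → ∀ a ∈ C ⊔ (K ∙ (v + t • u)),
      ∀ b ∈ C ⊔ (K ∙ (v + t • u)), h a b = 0 := by
    intro t ht a ha b hb
    obtain ⟨a₁, ha₁, a₂, ha₂, rfl⟩ := Submodule.mem_sup.1 ha
    obtain ⟨b₁, hb₁, b₂, hb₂, rfl⟩ := Submodule.mem_sup.1 hb
    obtain ⟨c, rfl⟩ := Submodule.mem_span_singleton.1 ha₂
    obtain ⟨d, rfl⟩ := Submodule.mem_span_singleton.1 hb₂
    have h0 : h (v + t • u) (v + t • u) = 0 := by rw [hself, ht, add_neg_cancel]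
    have h1 := z.isotropic a₁ (hCz ha₁) b₁ (hCz hb₁)
    have h2 := hperpC t a₁ ha₁
    have h3 := H.ortho_comm (hperpC t b₁ hb₁)
    generalize v + t • u = e at *
    simp [h0, h1, h2, h3]
  symm
  refine Nat.card_congr (Equiv.ofBijective (fun t => ⟨⟨C ⊔ (K ∙ (v + t.1 • u)), hiso t.1 t.2, ?_⟩,
    le_sup_left, ?_⟩) ⟨?_, ?_⟩)
  · rw [Submodule.finrank_sup_span_singleton fun hmem => hnotz _ (hCz hmem), hC]
  · intro he
    have hcar : C ⊔ (K ∙ (v + t.1 • u)) = z.carrier := congrArg carrier he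
    exact hnotz t.1 (hcar ▸ Submodule.mem_sup_right (Submodule.mem_span_singleton_self _))
  · intro t t' he
    have hcar : C ⊔ (K ∙ (v + t.1 • u)) = C ⊔ (K ∙ (v + t'.1 • u)) :=
      congrArg (fun y => carrier y.1) he
    have h1 : v + t.1 • u ∈ C ⊔ (K ∙ (v + t.1 • u)) :=
      Submodule.mem_sup_right (Submodule.mem_span_singleton_self _)
    have h2 : v + t'.1 • u ∈ C ⊔ (K ∙ (v + t.1 • u)) :=
      hcar ▸ Submodule.mem_sup_right (Submodule.mem_span_singleton_self _)
    by_contra hne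
    have hne' : t.1 - t'.1 ≠ 0 := sub_ne_zero.2 fun h0 => hne (Subtype.ext h0)
    have h3 : (t.1 - t'.1) • u ∈ C ⊔ (K ∙ (v + t.1 • u)) := by
      have := Submodule.sub_mem _ h1 h2
      rwa [add_sub_add_left_eq_sub, ← sub_smul] at this
    -- If two parameters gave the same subspace, it would contain both $u$ and $v+tu$, contradicting
    -- $h(v+tu,u)=1$.
    have h4 := hiso t.1 t.2 _ h1 _ ((Submodule.smul_mem_iff _ hne').1 h3)
    rw [map_add, LinearMap.add_apply, hvu, map_smulₛₗ, LinearMap.smul_apply, huu, smul_zero,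
      add_zero] at h4
    exact one_ne_zero h4
  · rintro ⟨y, hCy, hyz⟩
    obtain ⟨e, hey, hez⟩ : ∃ e ∈ y.carrier, e ∉ z.carrier := by
      by_contra! hcon
      exact hyz (eq_of_carrier_le hcon)
    have heC : e ∈ C.orthogonalBilin h := y.le_orthogonal hCy hey
    rw [← hspan'] at heC
    obtain ⟨e₁, he₁, e₂, he₂, rfl⟩ := Submodule.mem_sup.1 heC
    obtain ⟨a, rfl⟩ := Submodule.mem_span_singleton.1 he₂
    rw [← hspan] at he₁
    obtain ⟨c, hc, e₃, he₃, rfl⟩ := Submodule.mem_sup.1 he₁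
    obtain ⟨b, rfl⟩ := Submodule.mem_span_singleton.1 he₃
    have ha : a ≠ 0 := by
      rintro rfl
      refine hez ?_
      rw [zero_smul, add_zero]
      exact z.carrier.add_mem (hCz hc) (z.carrier.smul_mem b huz)
    have hmem : v + (a⁻¹ * b) • u ∈ y.carrier := by
      have h1 := y.carrier.smul_mem a⁻¹ (y.carrier.sub_mem hey (hCy hc))
      convert h1 using 1
      rw [add_assoc, add_sub_cancel_left, smul_add, smul_smul, smul_smul, inv_mul_cancel₀ ha,
        one_smul, add_comm]
    have ht : a⁻¹ * b + σ (a⁻¹ * b) = -h v v := by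
      have := y.isotropic _ hmem _ hmem
      rw [hself] at this
      linear_combination this
    refine ⟨⟨a⁻¹ * b, ht⟩, Subtype.ext (IsotropicSubspace.ext ?_)⟩
    exact sup_span_singleton_eq hCy (hC.trans y.finrank_eq.symm) hmem
      fun h0 => hnotz _ (hCz h0)

end IsotropicSubspace

/-! ### Intervals of hyperplanes as finite sets. -/

section HyperplaneFinset

variable {K V : Type*} [Field K] [AddCommGroup V] [Module K V] [Finite K] [FiniteDimensional K V]

theorem finite_submodule (K V : Type*) [Field K] [AddCommGroup V] [Module K V] [Finite K]
    [FiniteDimensional K V] : Finite (Submodule K V) :=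
  haveI : Finite V := Module.finite_of_finite K
  Finite.of_injective (fun W : Submodule K V => (W : Set V)) SetLike.coe_injective

open scoped Classical in
/-- The finite set of the hyperplanes of `B` containing `A`. -/
def hyperplanesBetween (A B : Submodule K V) : Finset (Submodule K V) :=
  haveI := finite_submodule K V
  haveI := Fintype.ofFinite (Submodule K V)
  {C | A ≤ C ∧ C ≤ B ∧ Module.finrank K C + 1 = Module.finrank K B}

theorem mem_hyperplanesBetween {A B C : Submodule K V} : C ∈ hyperplanesBetween A B ↔
    A ≤ C ∧ C ≤ B ∧ Module.finrank K C + 1 = Module.finrank K B := by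
  simp [hyperplanesBetween]

theorem card_hyperplanesBetween {A B : Submodule K V} (hAB : A ≤ B) {n : ℕ}
    (hn : Module.finrank K B = Module.finrank K A + n) :
    (hyperplanesBetween A B).card = ∑ k ∈ Finset.range n, Nat.card K ^ k := by
  rw [← natCard_hyperplanes_between hAB hn]
  refine (Nat.subtype_card _ fun C => mem_hyperplanesBetween).symm

end HyperplaneFinset

/-! ### Counting upper neighbours, common upper neighbours and intermediate vertices. -/

namespace IsotropicSubspace

variable {K V : Type*} [Field K] [AddCommGroup V] [Module K V]
  {σ : K →+* K} {h : V →ₛₗ[σ] V →ₗ[K] K} {D r : ℕ}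
  [Finite K] [FiniteDimensional K V] {x y z w p : IsotropicSubspace h D}

/-- A vector of $y\cap x$ is orthogonal to $C\le y$ and to $z\cap x\le x$, hence to their sum, which
is $z$. So it lies in $z^\perp=z$, and $y\cap x\le (y\cap z)\cap x=C\cap x=U$. -/
theorem meet_eq_of_le (H : IsFiniteHermitian h D r) {U C : Submodule K V} (hUz : U ≤ x.meet z)
    (hU : Module.finrank K U + 1 = Module.finrank K (x.meet z)) (hUC : U ≤ C)
    (hC : Module.finrank K C + 1 = D) (hzC : ¬ x.meet z ≤ C) (hCz : C ≤ z.carrier)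
    (hCy : C ≤ y.carrier) (hyz : y ≠ z) : x.meet y = U := by
  have hlt : C ⊓ x.carrier < x.meet z :=
    lt_of_le_of_ne (inf_le_inf_right _ hCz) fun he => hzC (he ▸ inf_le_left)
  have h1 := Submodule.finrank_lt_finrank_of_lt hlt
  have hCU : U = C ⊓ x.carrier := Submodule.eq_of_le_of_finrank_le
    (le_inf hUC (hUz.trans (x.meet_le_right z))) (by omega)
  refine le_antisymm ?_ (le_inf (hUC.trans hCy) (hUz.trans (x.meet_le_right z)))
  rw [hCU]
  refine le_inf ?_ (x.meet_le_right y)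
  rw [← inf_eq_of_le hyz hC hCy hCz]
  refine le_inf (z.le_of_le_orthogonal H ?_) (x.meet_le_left y)
  have hsup : C ⊔ x.meet z = z.carrier := by
    refine Submodule.eq_of_le_of_finrank_le (sup_le hCz (x.meet_le_left z)) ?_
    have := Submodule.finrank_lt_finrank_of_lt (left_lt_sup.2 hzC)
    have := z.finrank_eq
    omega
  intro a ha b hb
  rw [← hsup] at hb
  obtain ⟨b₁, hb₁, b₂, hb₂, rfl⟩ := Submodule.mem_sup.1 hb
  rw [map_add, LinearMap.add_apply, y.isotropic b₁ (hCy hb₁) a ha.1,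
    x.isotropic b₂ hb₂.2 a ha.2, add_zero]

open scoped Classical in
theorem filter_isLower_inf_eq (H : IsFiniteHermitian h D r) {U C : Submodule K V}
    (hUz : U ≤ x.meet z)
    (hU : Module.finrank K U + 1 = Module.finrank K (x.meet z)) (hUC : U ≤ C)
    (hCz : C ≤ z.carrier) (hC : Module.finrank K C + 1 = D) (hzC : ¬ x.meet z ≤ C) :
    (Finset.univ.filter fun y => (x.IsLower z y ∧ x.meet y = U) ∧ z.carrier ⊓ y.carrier = C) =
      Finset.univ.filter fun y : IsotropicSubspace h D => C ≤ y.carrier ∧ y ≠ z := by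
  ext y
  simp only [Finset.mem_filter, Finset.mem_univ, true_and]
  constructor
  · rintro ⟨⟨hzy, -⟩, rfl⟩
    exact ⟨inf_le_right, fun he => hzC (by rw [he, inf_idem]; exact x.meet_le_left z)⟩
  · rintro ⟨hCy, hyz⟩
    have hmeet := meet_eq_of_le H hUz hU hUC hC hzC hCz hCy hyz
    exact ⟨⟨⟨adj_of_le hyz hC hCy hCz, by rw [hmeet, hU]⟩, hmeet⟩, inf_eq_of_le hyz hC hCy hCz⟩

open scoped Classical in
/-- The number of the vertices above `z` that meet `x` in a given hyperplane of `z ∩ x`. -/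
theorem card_upper_meet_eq (H : IsFiniteHermitian h D r) {U : Submodule K V}
    (hUz : U ≤ x.meet z) (hU : Module.finrank K U + 1 = Module.finrank K (x.meet z)) {n : ℕ}
    (hn : D = Module.finrank K (x.meet z) + n) :
    (Finset.univ.filter fun y => x.IsLower z y ∧ x.meet y = U).card = r * (r ^ 2) ^ n := by
  have hsub : hyperplanesBetween (x.meet z) z.carrier ⊆ hyperplanesBetween U z.carrier := by
    intro C hC
    rw [mem_hyperplanesBetween] at hC ⊢
    exact ⟨hUz.trans hC.1, hC.2⟩
  have hz := z.finrank_eq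
  -- The upper neighbours are sorted by $C=z\cap y$, which runs over the hyperplanes of $z$ that
  -- contain $U$ but not $z\cap x$. There are $(r^2)^n$ of these, a difference of two consecutive
  -- geometric sums, and each carries $r$ vertices.
  rw [Finset.card_eq_sum_card_fiberwise (f := fun y => z.carrier ⊓ y.carrier)
    (t := hyperplanesBetween U z.carrier \ hyperplanesBetween (x.meet z) z.carrier)]
  · rw [Finset.sum_congr rfl (g := fun _ => r), Finset.sum_const, smul_eq_mul,
      Finset.card_sdiff_of_subset hsub,
      card_hyperplanesBetween (n := n + 1) (hUz.trans (x.meet_le_left z)) (by omega),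
      card_hyperplanesBetween (n := n) (x.meet_le_left z) (by omega), Finset.sum_range_succ,
      Nat.add_sub_cancel_left, H.card_eq, mul_comm]
    intro C hC
    rw [Finset.mem_sdiff, mem_hyperplanesBetween, mem_hyperplanesBetween] at hC
    obtain ⟨⟨hUC, hCz, hdim⟩, hnot⟩ := hC
    have hzC : ¬ x.meet z ≤ C := fun hle => hnot ⟨hle, hCz, hdim⟩
    rw [Finset.filter_filter,
      filter_isLower_inf_eq H hUz hU hUC hCz (hdim.trans hz) hzC,
      ← natCard_line H z hCz (hdim.trans hz), Nat.card_eq_fintype_card, Fintype.card_subtype]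
  · intro y hy
    simp only [Finset.coe_filter, Finset.mem_univ, true_and, Set.mem_ofPred_eq] at hy
    obtain ⟨hzy, rfl⟩ := hy
    simp only [Finset.coe_sdiff, Set.mem_sdiff, Finset.mem_coe, mem_hyperplanesBetween]
    refine ⟨⟨le_inf (hzy.meet_le.trans (x.meet_le_left z)) (x.meet_le_left y), inf_le_left,
      (finrank_adj hzy.1).trans hz.symm⟩, fun hcon => hzy.not_meet_le (hcon.1.trans inf_le_right)⟩

open scoped Classical in
/-- The number of the vertices above `z`. -/
theorem card_upper (H : IsFiniteHermitian h D r) (x z : IsotropicSubspace h D) {n : ℕ}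
    (hn : D = Module.finrank K (x.meet z) + n) :
    (Finset.univ.filter fun y => x.IsLower z y).card =
      (∑ k ∈ Finset.range (Module.finrank K (x.meet z)), (r ^ 2) ^ k) * (r * (r ^ 2) ^ n) := by
  rw [Finset.card_eq_sum_card_fiberwise (f := fun y => x.meet y)
    (t := hyperplanesBetween ⊥ (x.meet z))]
  · rw [Finset.sum_congr rfl (g := fun _ => r * (r ^ 2) ^ n), Finset.sum_const, smul_eq_mul,
      card_hyperplanesBetween bot_le (n := Module.finrank K (x.meet z)) (by simp), H.card_eq]
    intro U hU
    rw [mem_hyperplanesBetween] at hU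
    rw [Finset.filter_filter, card_upper_meet_eq H hU.2.1 hU.2.2 hn]
  · intro y hy
    simp only [Finset.coe_filter, Finset.mem_univ, true_and, Set.mem_ofPred_eq] at hy
    rw [Finset.mem_coe, mem_hyperplanesBetween]
    exact ⟨bot_le, hy.meet_le, hy.2.symm⟩

/-- The space $z\cap w$ is orthogonal to $z\cap x$ and to $w\cap x$, hence to their sum $p\cap x$,
and $z\cap(p\cap x)^\perp=p\cap z$. -/
theorem IsLower.inf_le (H : IsFiniteHermitian h D r) (hpz : x.IsLower p z) (hpw : x.IsLower p w)
    (hzw : x.meet z ≠ x.meet w) : z.carrier ⊓ w.carrier ≤ p.carrier := by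
  have hle : z.carrier ⊓ w.carrier ≤ z.carrier ⊓ (x.meet p).orthogonalBilin h := by
    refine le_inf inf_le_left fun a ha b hb => ?_
    rw [hpz.meet_eq_sup hpw hzw] at hb
    obtain ⟨b₁, hb₁, b₂, hb₂, rfl⟩ := Submodule.mem_sup.1 hb
    rw [map_add, LinearMap.add_apply, z.isotropic b₁ hb₁.1 a ha.1,
      w.isotropic b₂ hb₂.1 a ha.2, add_zero]
  exact hle.trans ((hpz.inf_eq H).symm.le.trans inf_le_left)

theorem IsLower.finrank_inf (H : IsFiniteHermitian h D r) (hpz : x.IsLower p z)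
    (hpw : x.IsLower p w) (hzw : x.meet z ≠ x.meet w) :
    Module.finrank K (z.carrier ⊓ w.carrier : Submodule K V) + 2 = D := by
  have h1 : (p.carrier ⊓ z.carrier) ⊓ (p.carrier ⊓ w.carrier) = z.carrier ⊓ w.carrier :=
    le_antisymm (inf_le_inf inf_le_right inf_le_right)
      (le_inf (le_inf (hpz.inf_le H hpw hzw) inf_le_left)
        (le_inf (hpz.inf_le H hpw hzw) inf_le_right))
  have h2 := finrank_inf_add_of_hyperplanes
    (inf_le_left : p.carrier ⊓ z.carrier ≤ p.carrier)
    (inf_le_left : p.carrier ⊓ w.carrier ≤ p.carrier)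
  rw [h1] at h2
  have hlt : z.carrier ⊓ w.carrier < p.carrier ⊓ z.carrier := by
    refine lt_of_le_of_ne (le_inf (hpz.inf_le H hpw hzw) inf_le_left) fun he => hzw ?_
    have h3 : x.meet z ≤ w.carrier :=
      (le_inf (hpz.meet_le.trans (x.meet_le_left p)) (x.meet_le_left z)).trans
        (he.symm.le.trans inf_le_right)
    refine Submodule.eq_of_le_of_finrank_eq (le_inf h3 (x.meet_le_right z)) ?_
    have := hpz.2
    have := hpw.2
    change Module.finrank K (x.meet z) = Module.finrank K (x.meet w)
    omega
  have h3 := Submodule.finrank_lt_finrank_of_lt hlt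
  have := finrank_adj hpz.1
  have := finrank_adj hpw.1
  have := p.finrank_eq
  omega

/-- A common upper neighbour `y` of `z` and `w` is determined by `z ∩ y`. -/
theorem IsLower.upper_carrier_eq (H : IsFiniteHermitian h D r) (hpz : x.IsLower p z)
    (hpw : x.IsLower p w) (hzw : x.meet z ≠ x.meet w) (hzy : x.IsLower z y)
    (hwy : x.IsLower w y) :
    z.carrier ⊓ w.carrier ≤ y.carrier ∧
    (z.carrier ⊓ y.carrier) ⊔ (w.carrier ⊓ (z.carrier ⊓ y.carrier).orthogonalBilin h) =
      y.carrier := by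
  have hM := hpz.finrank_inf H hpw hzw
  have hy := y.finrank_eq
  have hw := w.finrank_eq
  have hz1 := finrank_adj hzy.1
  have hw1 := finrank_adj hwy.1
  -- Two hyperplanes $z\cap y$ and $w\cap y$ of $y$ meet in dimension at least $D-2=\dim(z\cap w)$,
  -- so their intersection is all of $z\cap w$. In particular they are distinct and span $y$.
  have h1 := finrank_inf_add_of_hyperplanes
    (inf_le_right : z.carrier ⊓ y.carrier ≤ y.carrier)
    (inf_le_right : w.carrier ⊓ y.carrier ≤ y.carrier)
  have h2 : (z.carrier ⊓ y.carrier) ⊓ (w.carrier ⊓ y.carrier) ≤ z.carrier ⊓ w.carrier :=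
    inf_le_inf inf_le_left inf_le_left
  have h3 := Submodule.eq_of_le_of_finrank_le h2 (by omega)
  rw [h3] at h1
  refine ⟨h3 ▸ inf_le_left.trans inf_le_right, ?_⟩
  have hwy' : w.carrier ⊓ y.carrier =
      w.carrier ⊓ (z.carrier ⊓ y.carrier).orthogonalBilin h := by
    refine Submodule.eq_of_le_of_finrank_le
      (le_inf inf_le_left (inf_le_right.trans (y.le_orthogonal inf_le_right))) ?_
    have hlt : w.carrier ⊓ (z.carrier ⊓ y.carrier).orthogonalBilin h < w.carrier := by
      refine lt_of_le_of_ne inf_le_left fun he => ?_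
      have h4 : z.carrier ⊓ y.carrier ≤ z.carrier ⊓ w.carrier :=
        le_inf inf_le_left (w.le_of_carrier_le_orthogonal H (he ▸ inf_le_right))
      have := Submodule.finrank_mono h4
      omega
    have := Submodule.finrank_lt_finrank_of_lt hlt
    omega
  rw [← hwy']
  refine Submodule.eq_of_le_of_finrank_le (sup_le inf_le_right inf_le_right) ?_
  have h5 := Submodule.finrank_sup_add_finrank_inf_eq (z.carrier ⊓ y.carrier)
    (w.carrier ⊓ y.carrier)
  rw [h3] at h5
  omega

-- A common upper neighbour $y$ is recovered from the hyperplane $z\cap y$ of $z$. This hyperplane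
-- contains $z\cap w$, of codimension two in $z$, and differs from $p\cap z$, which contains $z\cap
-- x$; that leaves $r^2$ of the $r^2+1$ candidates.
open scoped Classical in
theorem IsLower.card_upper_common_le (H : IsFiniteHermitian h D r) (hpz : x.IsLower p z)
    (hpw : x.IsLower p w) (hzw : x.meet z ≠ x.meet w) :
    (Finset.univ.filter fun y => x.IsLower z y ∧ x.IsLower w y).card ≤ r ^ 2 := by
  have hM := hpz.finrank_inf H hpw hzw
  have hz := z.finrank_eq
  have hpz1 := finrank_adj hpz.1
  have hcard : ((hyperplanesBetween (z.carrier ⊓ w.carrier) z.carrier).erase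
      (p.carrier ⊓ z.carrier)).card = r ^ 2 := by
    rw [Finset.card_erase_of_mem, card_hyperplanesBetween (n := 2) inf_le_left (by omega),
      H.card_eq]
    · simp [Finset.sum_range_succ]
    · rw [mem_hyperplanesBetween]
      exact ⟨le_inf (hpz.inf_le H hpw hzw) inf_le_left, inf_le_right, by omega⟩
  rw [← hcard]
  refine Finset.card_le_card_of_injOn (fun y => z.carrier ⊓ y.carrier) ?_ ?_
  · intro y hy
    simp only [Finset.coe_filter, Finset.mem_univ, true_and, Set.mem_ofPred_eq] at hy
    have h1 := hpz.upper_carrier_eq H hpw hzw hy.1 hy.2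
    have h2 := finrank_adj hy.1.1
    rw [Finset.mem_coe, Finset.mem_erase, mem_hyperplanesBetween]
    refine ⟨fun he => hy.1.not_meet_le ?_, le_inf inf_le_left h1.1, inf_le_left, h2.trans hz.symm⟩
    exact (le_inf (hpz.meet_le.trans (x.meet_le_left p)) (x.meet_le_left z)).trans
      (he.symm.le.trans inf_le_right)
  · intro y hy y' hy' he
    simp only [Finset.coe_filter, Finset.mem_univ, true_and, Set.mem_ofPred_eq] at hy hy' he
    have h1 := (hpz.upper_carrier_eq H hpw hzw hy.1 hy.2).2
    have h2 := (hpz.upper_carrier_eq H hpw hzw hy'.1 hy'.2).2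
    exact IsotropicSubspace.ext (by rw [← h1, ← h2, he])

open scoped Classical in
/-- Two vertices with a common lower neighbour and different intersections with `x` have `r ^ 2`
common upper neighbours. -/
theorem IsLower.card_upper_common (H : IsFiniteHermitian h D r) (hpz : x.IsLower p z)
    (hpw : x.IsLower p w) (hzw : x.meet z ≠ x.meet w) :
    (Finset.univ.filter fun y => x.IsLower z y ∧ x.IsLower w y).card = r ^ 2 := by
  have hdz := hpz.2
  have hdw := hpw.2
  have hUdim := hpz.finrank_meet_inf hpw hzw
  obtain ⟨n, hn⟩ : ∃ n, D = Module.finrank K (x.meet p) + n :=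
    Nat.exists_eq_add_of_le ((Submodule.finrank_mono (x.meet_le_left p)).trans_eq p.finrank_eq)
  set U := x.meet z ⊓ x.meet w with hU
  set Y := Finset.univ.filter fun y => x.IsLower z y ∧ x.meet y = U with hY
  set W := Finset.univ.filter fun w' => x.IsLower p w' ∧ x.meet w' = x.meet w with hW
  have hYcard : Y.card = r * (r ^ 2) ^ (n + 1) :=
    card_upper_meet_eq H inf_le_left hUdim (by omega)
  have hWcard : W.card = r * (r ^ 2) ^ n :=
    card_upper_meet_eq H hpw.meet_le (by omega) hn
  -- Every $y\in Y$ lies above exactly one $w'$ with $w'\cap x=w\cap x$, and that $w'$ belongs to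
  -- $W$ by `exchange`. Since $|Y|=r^2|W|$, the upper bound $r^2$ is attained on average over $W$,
  -- hence for every $w'$ and in particular for $w$.
  have hcount : ∑ w' ∈ W, (Y.filter fun y => x.IsLower w' y).card = ∑ w' ∈ W, r ^ 2 := by
    have h1 := Finset.sum_card_bipartiteAbove_eq_sum_card_bipartiteBelow
      (s := W) (t := Y) (fun w' y => x.IsLower w' y)
    refine h1.trans ?_
    rw [Finset.sum_const, smul_eq_mul, hWcard, Finset.sum_congr rfl (g := fun _ => 1),
      Finset.sum_const, smul_eq_mul, hYcard]
    · ring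
    intro y hy
    simp only [hY, Finset.mem_filter, Finset.mem_univ, true_and] at hy
    rw [Finset.card_eq_one]
    have hyU : Module.finrank K (x.meet w) = Module.finrank K (x.meet y) + 1 := by
      rw [hy.2]
      omega
    obtain ⟨w', hw'y, hw'⟩ := exists_isLower H x y (x.meet_le_right w) (hy.2 ▸ inf_le_right) hyU
    refine ⟨w', ?_⟩
    ext w''
    simp only [Finset.bipartiteBelow, hW, Finset.mem_filter, Finset.mem_univ, true_and,
      Finset.mem_singleton]
    constructor
    · rintro ⟨⟨-, h2⟩, h3⟩
      exact h3.unique H hw'y (h2.trans hw'.symm)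
    · rintro rfl
      exact ⟨⟨hy.1.exchange H hpz hw'y (hw' ▸ hpw.meet_le), hw'⟩, hw'y⟩
  have hle : ∀ w' ∈ W, (Y.filter fun y => x.IsLower w' y).card ≤ r ^ 2 := by
    intro w' hw'
    simp only [hW, Finset.mem_filter, Finset.mem_univ, true_and] at hw'
    refine le_trans (Finset.card_le_card ?_)
      (hpz.card_upper_common_le H hw'.1 (hw'.2 ▸ hzw))
    intro y hy
    simp only [hY, Finset.mem_filter, Finset.mem_univ, true_and] at hy ⊢
    exact ⟨hy.1.1, hy.2⟩
  have hwW : w ∈ W := by simp [hW, hpw]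
  rw [← (Finset.sum_eq_sum_iff_of_le hle).1 hcount w hwW]
  congr 1
  ext y
  simp only [hY, Finset.mem_filter, Finset.mem_univ, true_and]
  exact ⟨fun hy => ⟨⟨hy.1, (finrank_meet_sup hy.1 hy.2 hzw).1.symm⟩, hy.2⟩,
    fun hy => ⟨hy.1.1, hy.2⟩⟩

open scoped Classical in
/-- Between `p` and `y` there are `r ^ 2` vertices besides a given one. -/
theorem IsLower.card_between (H : IsFiniteHermitian h D r) (hzy : x.IsLower z y)
    (hpz : x.IsLower p z) :
    (Finset.univ.filter fun z' =>
      x.IsLower z' y ∧ x.IsLower p z' ∧ x.meet z' ≠ x.meet z).card = r ^ 2 := by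
  have hdz := hzy.2
  have hdp := hpz.2
  have hcard : ((hyperplanesBetween (x.meet y) (x.meet p)).erase (x.meet z)).card = r ^ 2 := by
    rw [Finset.card_erase_of_mem, card_hyperplanesBetween (n := 2)
      (hzy.meet_le.trans hpz.meet_le) (by omega), H.card_eq]
    · simp [Finset.sum_range_succ]
    · rw [mem_hyperplanesBetween]
      exact ⟨hzy.meet_le, hpz.meet_le, by omega⟩
  rw [← hcard]
  refine Finset.card_bij (fun z' _ => x.meet z') ?_ ?_ ?_
  · intro z' hz'
    simp only [Finset.mem_filter, Finset.mem_univ, true_and] at hz'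
    rw [Finset.mem_erase, mem_hyperplanesBetween]
    exact ⟨hz'.2.2, hz'.1.meet_le, hz'.2.1.meet_le, hz'.2.1.2.symm⟩
  · intro z' hz' z'' hz'' he
    simp only [Finset.mem_filter, Finset.mem_univ, true_and] at hz' hz''
    exact hz'.1.unique H hz''.1 he
  · intro U hU
    rw [Finset.mem_erase, mem_hyperplanesBetween] at hU
    obtain ⟨z', hz'y, rfl⟩ := exists_isLower H x y (hU.2.2.1.trans (x.meet_le_right p)) hU.2.1
      (by omega)
    refine ⟨z', ?_, rfl⟩
    simp only [Finset.mem_filter, Finset.mem_univ, true_and]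
    exact ⟨hz'y, hzy.exchange H hpz hz'y hU.2.2.1, hU.1⟩

end IsotropicSubspace

/-! ### The matrix identities and the cubic relation. -/

namespace IsotropicSubspace

variable {K V : Type*} [Field K] [AddCommGroup V] [Module K V]
  {σ : K →+* K} {h : V →ₛₗ[σ] V →ₗ[K] K} {D r : ℕ}
  [Finite K] [FiniteDimensional K V] {x y z w p : IsotropicSubspace h D}

open scoped Classical in
/-- The common upper neighbours of two vertices. -/
def commonUpper (x z w : IsotropicSubspace h D) : Finset (IsotropicSubspace h D) :=
  {v | x.IsLower z v ∧ x.IsLower w v}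

open scoped Classical in
/-- The common lower neighbours of two vertices. -/
def commonLower (x z w : IsotropicSubspace h D) : Finset (IsotropicSubspace h D) :=
  {v | x.IsLower v z ∧ x.IsLower v w}

theorem mem_commonUpper {v : IsotropicSubspace h D} :
    v ∈ commonUpper x z w ↔ x.IsLower z v ∧ x.IsLower w v := by
  simp [commonUpper]

theorem mem_commonLower {v : IsotropicSubspace h D} :
    v ∈ commonLower x z w ↔ x.IsLower v z ∧ x.IsLower v w := by
  simp [commonLower]

/-- By the diamond property, common upper neighbours exist only if a common lower neighbour does. In
that case the lower one is unique and there are $r^2$ upper ones. -/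
theorem card_commonUpper (H : IsFiniteHermitian h D r) (hzw : x.meet z ≠ x.meet w) :
    (commonUpper x z w).card = r ^ 2 * (commonLower x z w).card := by
  by_cases hp : ∃ p, x.IsLower p z ∧ x.IsLower p w
  · obtain ⟨p, hpz, hpw⟩ := hp
    have h1 : commonLower x z w = {p} := by
      ext p'
      rw [mem_commonLower, Finset.mem_singleton]
      refine ⟨fun hp' => hp'.1.common_unique H hp'.2 hpz hpw hzw, ?_⟩
      rintro rfl
      exact ⟨hpz, hpw⟩
    rw [h1, Finset.card_singleton, mul_one]
    exact hpz.card_upper_common H hpw hzw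
  · have h1 : commonLower x z w = ∅ := Finset.eq_empty_of_forall_notMem fun p hmem =>
      hp ⟨p, mem_commonLower.1 hmem⟩
    have h2 : commonUpper x z w = ∅ := Finset.eq_empty_of_forall_notMem fun v hmem =>
      hp ((mem_commonUpper.1 hmem).1.exists_common H (mem_commonUpper.1 hmem).2 hzw)
    simp [h1, h2]

-- Double count of pairs $(z',p)$ with $p$ below both $z'$ and $w$. Since $p\cap x$ contains $w\cap
-- x=z\cap x$, `exchange` puts $p$ below $z$ as well, and each such $p$ admits $r^2$ choices of
-- $z'$.
open scoped Classical in
theorem sum_commonLower_of_ne (H : IsFiniteHermitian h D r) (hzy : x.IsLower z y)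
    (hzw : x.meet z = x.meet w) :
    ∑ z' ∈ Finset.univ.filter (fun z' => x.IsLower z' y ∧ z' ≠ z), (commonLower x z' w).card =
      r ^ 2 * (commonLower x w z).card := by
  have h1 := Finset.sum_card_bipartiteAbove_eq_sum_card_bipartiteBelow
    (s := Finset.univ.filter (fun z' => x.IsLower z' y ∧ z' ≠ z))
    (t := Finset.univ.filter (fun p => x.IsLower p w)) (fun z' p => x.IsLower p z')
  refine Eq.trans (Finset.sum_congr rfl fun z' _ => congrArg Finset.card ?_) (h1.trans ?_)
  · ext p
    simp only [mem_commonLower, Finset.bipartiteAbove, Finset.mem_filter, Finset.mem_univ,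
      true_and, and_comm]
  rw [mul_comm, ← smul_eq_mul, ← Finset.sum_const,
    ← Finset.sum_subset (s₁ := commonLower x w z)]
  · refine Finset.sum_congr rfl fun p hp => ?_
    rw [mem_commonLower] at hp
    rw [← hzy.card_between H hp.2]
    congr 1
    ext z'
    simp only [Finset.bipartiteBelow, Finset.mem_filter, Finset.mem_univ, true_and]
    refine ⟨fun hz' => ⟨hz'.1.1, hz'.2, fun he => hz'.1.2 (hz'.1.1.unique H hzy he)⟩,
      fun hz' => ⟨⟨hz'.1, ?_⟩, hz'.2.1⟩⟩
    rintro rfl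
    exact hz'.2.2 rfl
  · intro p hp
    rw [mem_commonLower] at hp
    simpa using hp.1
  · intro p hp hp'
    simp only [Finset.mem_filter, Finset.mem_univ, true_and] at hp
    rw [Finset.card_eq_zero]
    refine Finset.eq_empty_of_forall_notMem fun z' hz' => hp' ?_
    simp only [Finset.bipartiteBelow, Finset.mem_filter, Finset.mem_univ, true_and] at hz'
    rw [mem_commonLower]
    exact ⟨hp, hz'.1.1.exchange H hz'.2 hzy (hzw ▸ hp.meet_le)⟩

-- This is the entry $(w,y)$ of $LP$. Reordering the sum by the common lower neighbour $z'$ of $y'$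
-- and $y$, the term $z'=z$ contributes only when $w=z$. For every other $z'$, all common upper
-- neighbours of $z'$ and $w$ automatically meet $x$ in $y\cap x$, which gives one factor $r^2$;
-- `sum_commonLower_of_ne` gives the second.
open scoped Classical in
theorem sum_upper_commonLower (H : IsFiniteHermitian h D r) (hzy : x.IsLower z y)
    (hzw : x.meet z = x.meet w) {n : ℕ} (hn : D = Module.finrank K (x.meet z) + n) :
    ∑ y' ∈ Finset.univ.filter (fun y' => x.IsLower w y' ∧ x.meet y' = x.meet y),
        (commonLower x y' y).card =
      (if w = z then r * (r ^ 2) ^ n else 0) + r ^ 2 * (r ^ 2 * (commonLower x w z).card) := by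
  have h1 := Finset.sum_card_bipartiteAbove_eq_sum_card_bipartiteBelow
    (s := Finset.univ.filter (fun y' => x.IsLower w y' ∧ x.meet y' = x.meet y))
    (t := Finset.univ.filter (fun z' => x.IsLower z' y)) (fun y' z' => x.IsLower z' y')
  refine Eq.trans (Finset.sum_congr rfl fun z' _ => congrArg Finset.card ?_) (h1.trans ?_)
  · ext p
    simp only [mem_commonLower, Finset.bipartiteAbove, Finset.mem_filter, Finset.mem_univ,
      true_and, and_comm]
  rw [← sum_commonLower_of_ne H hzy hzw, Finset.mul_sum,
    ← Finset.add_sum_erase _ _ (show z ∈ Finset.univ.filter (fun z' => x.IsLower z' y) by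
      simpa using hzy)]
  congr 1
  · split_ifs with hwz
    · subst hwz
      rw [← card_upper_meet_eq H hzy.meet_le hzy.2.symm hn]
      congr 1
      ext y'
      simp only [Finset.bipartiteBelow, Finset.mem_filter, Finset.mem_univ, true_and]
      tauto
    · rw [Finset.card_eq_zero]
      refine Finset.eq_empty_of_forall_notMem fun y' hy' => hwz ?_
      simp only [Finset.bipartiteBelow, Finset.mem_filter, Finset.mem_univ, true_and] at hy'
      exact hy'.1.1.unique H hy'.2 hzw.symm
  · refine Finset.sum_congr ?_ fun z' hz' => ?_
    · ext z'
      simp [and_comm]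
    · simp only [Finset.mem_filter, Finset.mem_univ, true_and] at hz'
      have hne : x.meet z' ≠ x.meet z := fun he => hz'.2 (hz'.1.unique H hzy he)
      rw [← card_commonUpper H (hzw ▸ hne)]
      congr 1
      ext y'
      simp only [mem_commonUpper, Finset.bipartiteBelow, Finset.mem_filter, Finset.mem_univ,
        true_and]
      refine ⟨fun hy' => ⟨hy'.2, hy'.1.1⟩, fun hy' => ⟨⟨hy'.2, ?_⟩, hy'.1⟩⟩
      rw [← (finrank_meet_sup hy'.1 hy'.2 (hzw ▸ hne)).1, ← hzw, (finrank_meet_sup hz'.1 hzy hne).1]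

open scoped Classical in
/-- The matrix of the relation `x.IsLower`. -/
def lowerMat (x : IsotropicSubspace h D) :
    Matrix (IsotropicSubspace h D) (IsotropicSubspace h D) ℂ :=
  Matrix.of fun z y => if x.IsLower z y then 1 else 0

open scoped Classical in
/-- The part of `lowerMatᵀ * lowerMat` that preserves the intersection with `x`. -/
def pencilMat (x : IsotropicSubspace h D) :
    Matrix (IsotropicSubspace h D) (IsotropicSubspace h D) ℂ :=
  Matrix.of fun z y => if x.meet z = x.meet y then ((commonLower x z y).card : ℂ) else 0

theorem lowerMat_mul_transpose_apply (x z w : IsotropicSubspace h D) :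
    (lowerMat x * (lowerMat x)ᵀ) z w = (commonUpper x z w).card := by
  classical
  simp only [Matrix.mul_apply, Matrix.transpose_apply, lowerMat, Matrix.of_apply, commonUpper,
    ← ite_and, mul_ite, mul_one, mul_zero, Finset.card_filter, Nat.cast_sum, Nat.cast_ite,
    Nat.cast_one, Nat.cast_zero]
  refine Finset.sum_congr rfl fun v _ => if_congr and_comm rfl rfl

theorem transpose_mul_lowerMat_apply (x z w : IsotropicSubspace h D) :
    ((lowerMat x)ᵀ * lowerMat x) z w = (commonLower x z w).card := by
  classical
  simp only [Matrix.mul_apply, Matrix.transpose_apply, lowerMat, Matrix.of_apply, commonLower,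
    ← ite_and, mul_ite, mul_one, mul_zero, Finset.card_filter, Nat.cast_sum, Nat.cast_ite,
    Nat.cast_one, Nat.cast_zero]
  refine Finset.sum_congr rfl fun v _ => if_congr and_comm rfl rfl

open scoped Classical in
theorem lowerMat_mul_transpose (H : IsFiniteHermitian h D r) (x : IsotropicSubspace h D) :
    lowerMat x * (lowerMat x)ᵀ =
      Matrix.diagonal (fun z => ((Finset.univ.filter fun y => x.IsLower z y).card : ℂ)) +
      (r : ℂ) ^ 2 • ((lowerMat x)ᵀ * lowerMat x) - (r : ℂ) ^ 2 • pencilMat x := by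
  ext z w
  rw [Matrix.sub_apply, Matrix.add_apply, Matrix.smul_apply, Matrix.smul_apply,
    lowerMat_mul_transpose_apply, transpose_mul_lowerMat_apply, pencilMat, Matrix.of_apply]
  by_cases hzw : x.meet z = x.meet w
  · rw [if_pos hzw, add_sub_cancel_right]
    by_cases he : z = w
    · subst he
      simp [commonUpper]
    · rw [Matrix.diagonal_apply_ne _ he, Nat.cast_eq_zero, Finset.card_eq_zero]
      exact Finset.eq_empty_of_forall_notMem fun v hv =>
        he ((mem_commonUpper.1 hv).1.unique H (mem_commonUpper.1 hv).2 hzw)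
  · rw [if_neg hzw, Matrix.diagonal_apply_ne _ fun he => hzw (congrArg x.meet he),
      card_commonUpper H hzw]
    simp

open scoped Classical in
theorem lowerMat_mul_pencilMat (H : IsFiniteHermitian h D r) (x : IsotropicSubspace h D) :
    lowerMat x * pencilMat x =
      Matrix.diagonal (fun w => (r : ℂ) * ((r : ℂ) ^ 2) ^ (D - Module.finrank K (x.meet w))) *
        lowerMat x + ((r : ℂ) ^ 2 * (r : ℂ) ^ 2) • (pencilMat x * lowerMat x) := by
  ext w y
  have h1 : (lowerMat x * pencilMat x) w y =
      ((∑ y' ∈ Finset.univ.filter (fun y' => x.IsLower w y' ∧ x.meet y' = x.meet y),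
        (commonLower x y' y).card : ℕ) : ℂ) := by
    simp only [Matrix.mul_apply, lowerMat, pencilMat, Matrix.of_apply, Finset.sum_filter,
      Nat.cast_sum, Nat.cast_ite, Nat.cast_zero, ite_mul, one_mul, zero_mul, ite_and]
  rw [h1, Matrix.add_apply, Matrix.smul_apply, Matrix.diagonal_mul]
  -- If no lower neighbour of $y$ has the same meet as $w$, all three entries vanish. Otherwise that
  -- neighbour $z$ is unique and $(PL)_{w,y}$ reduces to a single term.
  by_cases hz : ∃ z, x.IsLower z y ∧ x.meet z = x.meet w
  · obtain ⟨z, hzy, hzw⟩ := hz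
    obtain ⟨n, hn⟩ : ∃ n, D = Module.finrank K (x.meet z) + n :=
      Nat.exists_eq_add_of_le ((Submodule.finrank_mono (x.meet_le_left z)).trans_eq z.finrank_eq)
    have h2 : (pencilMat x * lowerMat x) w y = (commonLower x w z).card := by
      rw [Matrix.mul_apply, Finset.sum_eq_single z]
      · simp [pencilMat, lowerMat, hzy, hzw]
      · intro w' _ hw'
        by_cases hw'y : x.IsLower w' y
        · have : x.meet w ≠ x.meet w' := fun he => hw' (hw'y.unique H hzy (he.symm.trans hzw.symm))
          simp [pencilMat, this]
        · simp [lowerMat, hw'y]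
      · simp
    have h3 : x.IsLower w y ↔ w = z :=
      ⟨fun hwy => hwy.unique H hzy hzw.symm, fun he => he ▸ hzy⟩
    have h4 : D - Module.finrank K (x.meet w) = n := by
      rw [← hzw]
      omega
    rw [sum_upper_commonLower H hzy hzw hn, h2, h4]
    simp only [lowerMat, Matrix.of_apply, h3]
    split_ifs <;> push_cast <;> simp [mul_assoc]
  · have h2 : (pencilMat x * lowerMat x) w y = 0 := by
      rw [Matrix.mul_apply]
      refine Finset.sum_eq_zero fun w' _ => ?_
      by_cases hw'y : x.IsLower w' y
      · have : x.meet w ≠ x.meet w' := fun he => hz ⟨w', hw'y, he.symm⟩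
        simp [pencilMat, this]
      · simp [lowerMat, hw'y]
    have h3 : ¬ x.IsLower w y := fun hwy => hz ⟨w, hwy, rfl⟩
    rw [Finset.filter_eq_empty_iff.2, h2]
    · simp [lowerMat, h3]
    · rintro y' - ⟨hwy', hy'⟩
      obtain ⟨z, hzy, hzw⟩ := exists_isLower H x y (x.meet_le_right w) (hy' ▸ hwy'.meet_le)
        (hy' ▸ hwy'.2)
      exact hz ⟨z, hzy, hzw⟩

theorem lowerMat_relation (H : IsFiniteHermitian h D r) (x : IsotropicSubspace h D) :
    -((r : ℂ) ^ 4) • ((lowerMat x)ᵀ * (lowerMat x * lowerMat x)) +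
      ((r : ℂ) ^ 2 + 1) • (lowerMat x * (lowerMat x)ᵀ * lowerMat x) -
      ((r : ℂ) ^ 2)⁻¹ • (lowerMat x * lowerMat x * (lowerMat x)ᵀ) =
    (((r : ℂ) ^ 2 + 1) * (r : ℂ) ^ (2 * D - 1)) • lowerMat x := by
  classical
  have hI := lowerMat_mul_transpose H x
  have hII := lowerMat_mul_pencilMat H x
  have hr : (r : ℂ) ≠ 0 := Nat.cast_ne_zero.2 (by have := H.one_lt; omega)
  set L := lowerMat x with hL
  set P := pencilMat x
  set Δ := Matrix.diagonal (fun z => ((Finset.univ.filter fun y => x.IsLower z y).card : ℂ))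
    with hΔ
  set Θ := Matrix.diagonal (fun w => (r : ℂ) * ((r : ℂ) ^ 2) ^ (D - Module.finrank K (x.meet w)))
    with hΘ
  have e1 : L * Lᵀ * L = Δ * L + (r : ℂ) ^ 2 • (Lᵀ * (L * L)) - (r : ℂ) ^ 2 • (P * L) := by
    rw [hI, sub_mul, add_mul, smul_mul_assoc, smul_mul_assoc, mul_assoc]
  have e2 : L * L * Lᵀ = L * Δ + (r : ℂ) ^ 2 • (L * Lᵀ * L) - (r : ℂ) ^ 2 • (L * P) := by
    have := congrArg (L * ·) hI
    simpa only [mul_sub, mul_add, mul_smul_comm, ← mul_assoc] using this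
  -- This is what remains after eliminating $P$. With $k=\dim(y\cap x)$, $D=k+1+n$ and
  -- $S=\sum_{i<k}r^{2i}$, the coefficient is $r\,r^{2n}\bigl(r^2(S+r^{2k})-S+1\bigr)$, which equals
  -- $(r^2+1)r^{2D-1}$ because $(r^2-1)S=r^{2k}-1$.
  have e3 : (r : ℂ) ^ 2 • (Δ * L) - ((r : ℂ) ^ 2)⁻¹ • (L * Δ) + Θ * L =
      (((r : ℂ) ^ 2 + 1) * (r : ℂ) ^ (2 * D - 1)) • L := by
    ext w y
    simp only [Matrix.add_apply, Matrix.sub_apply, Matrix.smul_apply, hΔ, hΘ,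
      Matrix.diagonal_mul, Matrix.mul_diagonal, smul_eq_mul]
    by_cases hwy : x.IsLower w y
    · have hLwy : L w y = 1 := by simp [hL, lowerMat, hwy]
      obtain ⟨n, hn⟩ : ∃ n, D = Module.finrank K (x.meet w) + n :=
        Nat.exists_eq_add_of_le ((Submodule.finrank_mono (x.meet_le_left w)).trans_eq w.finrank_eq)
      have hdim := hwy.2
      obtain ⟨k, hk⟩ : ∃ k, Module.finrank K (x.meet y) = k := ⟨_, rfl⟩
      rw [hk] at hdim
      rw [card_upper H x w hn, card_upper H x y (n := n + 1) (by omega), hk, hdim, hLwy,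
        show D - (k + 1) = n by omega, show 2 * D - 1 = 2 * (k + n) + 1 by omega]
      have hg : ((∑ i ∈ Finset.range k, (r ^ 2) ^ i : ℕ) : ℂ) * ((r : ℂ) ^ 2 - 1) =
          ((r : ℂ) ^ 2) ^ k - 1 := by
        push_cast
        exact geom_sum_mul _ _
      rw [Finset.sum_range_succ]
      generalize (∑ i ∈ Finset.range k, (r ^ 2) ^ i : ℕ) = S at hg
      have hinv : ((r : ℂ) ^ 2)⁻¹ * (S * ((r : ℂ) * ((r : ℂ) ^ 2) ^ (n + 1))) =
          S * ((r : ℂ) * ((r : ℂ) ^ 2) ^ n) := by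
        rw [pow_succ]
        field_simp
        ring
      have hexp : (r : ℂ) ^ (2 * (k + n) + 1) = (r : ℂ) * ((r : ℂ) ^ 2) ^ k * ((r : ℂ) ^ 2) ^ n := by
        ring
      push_cast
      rw [one_mul, hinv, hexp]
      linear_combination (r : ℂ) * ((r : ℂ) ^ 2) ^ n * hg
    · have hLwy : L w y = 0 := by simp [hL, lowerMat, hwy]
      simp [hLwy]
  rw [← e3, e2, hII, e1]
  match_scalars <;> field_simp <;> ring

end IsotropicSubspace

/-! ### Distances from a rank function, and the entries of the lowering and raising matrices. -/

namespace SimpleGraph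

section RankFunction

variable {X : Type*} {G : SimpleGraph X} {x : X} {ρ : X → ℕ}

theorem exists_walk_length_eq_of_rank (h0 : ρ x = 0)
    (hdown : ∀ y, y ≠ x → ∃ z, G.Adj z y ∧ ρ y = ρ z + 1) (n : ℕ) :
    ∀ y, ρ y = n → ∃ W : G.Walk x y, W.length = n := by
  induction n with
  | zero =>
    intro y hy
    by_cases hyx : y = x
    · subst hyx
      exact ⟨Walk.nil, rfl⟩
    · obtain ⟨z, -, hz⟩ := hdown y hyx
      omega
  | succ n ih =>
    intro y hy
    obtain ⟨z, hzy, hz⟩ := hdown y (by rintro rfl; omega)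
    obtain ⟨W, hW⟩ := ih z (by omega)
    exact ⟨W.concat hzy, by rw [Walk.length_concat, hW]⟩

theorem connected_of_rank (h0 : ρ x = 0)
    (hdown : ∀ y, y ≠ x → ∃ z, G.Adj z y ∧ ρ y = ρ z + 1) : G.Connected := by
  refine (connected_iff_exists_forall_reachable G).2 ⟨x, fun y => ?_⟩
  obtain ⟨W, -⟩ := exists_walk_length_eq_of_rank h0 hdown _ y rfl
  exact W.reachable

theorem Walk.rank_le (hadj : ∀ y z, G.Adj y z → ρ z ≤ ρ y + 1) {u v : X} (W : G.Walk u v) :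
    ρ v ≤ ρ u + W.length := by
  induction W with
  | nil => simp
  | cons huv W ih =>
    have := hadj _ _ huv
    rw [Walk.length_cons]
    omega

/-- Descending one rank at a time gives a walk of length `ρ y`, and no walk is shorter because an
edge raises the rank by at most one. The criterion is stated for any graph so that it serves both
$\Gamma$ and $\Gamma_f$. -/
theorem dist_eq_of_rank (h0 : ρ x = 0) (hadj : ∀ y z, G.Adj y z → ρ z ≤ ρ y + 1)
    (hdown : ∀ y, y ≠ x → ∃ z, G.Adj z y ∧ ρ y = ρ z + 1) (y : X) : G.dist x y = ρ y := by
  obtain ⟨W, hW⟩ := exists_walk_length_eq_of_rank h0 hdown _ y rfl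
  refine le_antisymm (hW ▸ dist_le W) ?_
  obtain ⟨W', hW'⟩ := W.reachable.exists_walk_length_eq_dist
  have := W'.rank_le hadj
  omega

theorem Connected.eccent_eq_of_dist (hG : G.Connected) {D : ℕ} (hle : ∀ y, G.dist x y ≤ D)
    (hex : ∃ y, G.dist x y = D) : G.eccent x = D := by
  refine le_antisymm ((eccent_le_iff x D).2 fun y => ?_) ?_
  · rw [← (hG x y).coe_dist_eq_edist]
    exact_mod_cast hle y
  · obtain ⟨y, hy⟩ := hex
    rw [← hy, (hG x y).coe_dist_eq_edist]
    exact edist_le_eccent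

end RankFunction

section Matrices

variable {X : Type*} [Fintype X] {G : SimpleGraph X} {x : X} {D : ℕ}

theorem dualIdempotent_mul_adjMatrix_mul_apply [DecidableRel G.Adj] (i j : ℕ) (z y : X) :
    (G.dualIdempotent x i * G.adjMatrix ℂ * G.dualIdempotent x j) z y =
      if G.Adj z y ∧ G.dist x z = i ∧ G.dist x y = j then 1 else 0 := by
  classical
  rw [dualIdempotent, dualIdempotent, Matrix.mul_diagonal, Matrix.diagonal_mul, adjMatrix_apply]
  split_ifs <;> simp_all

open scoped Classical in
theorem loweringMatrix_eq (he : G.eccent x = D) (hle : ∀ y, G.dist x y ≤ D) :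
    G.loweringMatrix x =
      Matrix.of fun z y => if G.Adj z y ∧ G.dist x y = G.dist x z + 1 then 1 else 0 := by
  ext z y
  rw [loweringMatrix, he, ENat.toNat_natCast, Matrix.sum_apply]
  simp only [dualIdempotent_mul_adjMatrix_mul_apply, Matrix.of_apply]
  by_cases h : G.Adj z y ∧ G.dist x y = G.dist x z + 1
  · rw [if_pos h, Finset.sum_eq_single (G.dist x y)]
    · rw [if_pos ⟨h.1, by omega, rfl⟩]
    · exact fun i _ hi => if_neg fun hc => hi hc.2.2.symm
    · intro hi
      have := hle y
      rw [Finset.mem_Icc] at hi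
      omega
  · rw [if_neg h]
    refine Finset.sum_eq_zero fun i hi => if_neg fun hc => h ⟨hc.1, ?_⟩
    rw [Finset.mem_Icc] at hi
    omega

open scoped Classical in
theorem raisingMatrix_eq (he : G.eccent x = D) (hle : ∀ y, G.dist x y ≤ D) :
    G.raisingMatrix x =
      Matrix.of fun z y => if G.Adj z y ∧ G.dist x z = G.dist x y + 1 then 1 else 0 := by
  ext z y
  rw [raisingMatrix, he, ENat.toNat_natCast, Matrix.sum_apply]
  simp only [dualIdempotent_mul_adjMatrix_mul_apply, Matrix.of_apply]
  by_cases h : G.Adj z y ∧ G.dist x z = G.dist x y + 1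
  · rw [if_pos h, Finset.sum_eq_single (G.dist x y)]
    · rw [if_pos ⟨h.1, h.2, rfl⟩]
    · exact fun i _ hi => if_neg fun hc => hi hc.2.2.symm
    · intro hi
      have := hle z
      rw [Finset.mem_range] at hi
      omega
  · rw [if_neg h]
    refine Finset.sum_eq_zero fun i _ => if_neg fun hc => h ⟨hc.1, ?_⟩
    omega

theorem apply_eq_zero_of_mem_subconstituent {i : ℕ} {v : X → ℂ} (hv : v ∈ G.subconstituent x i)
    {y : X} (hy : G.dist x y ≠ i) : v y = 0 := by
  classical
  obtain ⟨w, rfl⟩ := hv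
  rw [Matrix.mulVecLin_apply, dualIdempotent, Matrix.mulVec_diagonal, if_neg hy, zero_mul]

theorem mulVec_eq_zero_of_mem_subconstituent {i : ℕ} {v : X → ℂ}
    (hv : v ∈ G.subconstituent x i) {M : Matrix X X ℂ}
    (hM : ∀ z y, G.dist x y = i → M z y = 0) : M *ᵥ v = 0 := by
  ext z
  refine Finset.sum_eq_zero fun y _ => ?_
  change M z y * v y = 0
  by_cases hy : G.dist x y = i
  · rw [hM z y hy, zero_mul]
  · rw [apply_eq_zero_of_mem_subconstituent hv hy, mul_zero]

end Matrices

end SimpleGraph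

/-! ### Nonsingularity of the principal submatrices of the parameter matrix. -/

section ParameterMatrix

open SimpleGraph

theorem entryFromOne_dualPolarParameterMatrix_pred (q : ℤ) {D i : ℕ} (h2 : 2 ≤ i) (hi : i ≤ D) :
    entryFromOne (dualPolarParameterMatrix q D) i (i - 1) =
      -((q : ℂ) ^ 4 / ((q : ℂ) ^ 2 + 1)) := by
  rw [entryFromOne, dif_pos (by omega), dualPolarParameterMatrix, Matrix.of_apply,
    if_neg (by rw [Fin.mk.injEq]; omega), if_pos (by simp only; omega)]

theorem eMinus_dualPolarParameterMatrix (q : ℤ) {D i : ℕ} (h2 : 2 ≤ i) (hi : i ≤ D) :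
    eMinus (dualPolarParameterMatrix q D) i = -((q : ℂ) ^ 4 / ((q : ℂ) ^ 2 + 1)) :=
  entryFromOne_dualPolarParameterMatrix_pred q h2 hi

theorem ePlus_dualPolarParameterMatrix (q : ℤ) {D i : ℕ} (h1 : 1 ≤ i) (hi : i + 1 ≤ D) :
    ePlus (dualPolarParameterMatrix q D) i =
      -((q : ℂ) ^ (-2 : ℤ) / ((q : ℂ) ^ 2 + 1)) := by
  rw [ePlus, entryFromOne, dif_pos (by omega), dualPolarParameterMatrix, Matrix.of_apply,
    if_neg (by rw [Fin.mk.injEq]; omega), if_neg (by simp only; omega),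
    if_pos (by simp only; omega)]

variable {r : ℕ}

theorem card_adjacent_fin_le {D : ℕ} (S : Finset (Fin D)) (k : Fin D) :
    (S.filter fun j : Fin D => (k : ℕ) = j + 1 ∨ (j : ℕ) = k + 1).card ≤ 2 := by
  refine le_trans (Finset.card_le_card_of_injOn (t := {(k : ℕ) - 1, (k : ℕ) + 1})
    (fun j => (j : ℕ)) ?_ (Fin.val_injective.injOn)) Finset.card_le_two
  intro j hj
  simp only [Finset.coe_filter, Set.mem_ofPred_eq] at hj
  simp only [Finset.coe_insert, Finset.coe_singleton, Set.mem_insert_iff, Set.mem_singleton_iff]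
  omega

/-- Conjugating by the diagonal matrix with entries `r ^ (3 * i)` makes the matrix strictly
diagonally dominant. -/
theorem det_dualPolarParameterMatrix_submatrix_ne_zero (hr : 1 < r) {D : ℕ} {ι : Type*} [Fintype ι]
    [DecidableEq ι] {f : ι → Fin D} (hf : Function.Injective f) :
    ((dualPolarParameterMatrix (-(r : ℤ)) D).submatrix f f).det ≠ 0 := by
  have hr0 : (r : ℂ) ≠ 0 := Nat.cast_ne_zero.2 (by omega)
  have hr1 : ((r : ℂ) ^ 2 + 1) ≠ 0 := by exact_mod_cast (by positivity : r ^ 2 + 1 ≠ 0)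
  set U := (dualPolarParameterMatrix (-(r : ℤ)) D).submatrix f f with hU
  set c : ι → ℂ := fun i => (r : ℂ) ^ (3 * (f i : ℕ)) with hc
  -- The product of opposite off-diagonal entries is $r^2/(r^2+1)^2=a^2$, and the factor $r^3$ per
  -- step balances $r^4$ against $r^{-2}$. A row has at most two off-diagonal entries, and $2a<1$ is
  -- $(r-1)^2>0$.
  set a : ℝ := r / ((r : ℝ) ^ 2 + 1) with ha
  have ha0 : 0 ≤ a := by positivity
  have ha1 : 2 * a < 1 := by
    rw [ha, ← mul_div_assoc, div_lt_one (by positivity)]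
    have : (1 : ℝ) < r := by exact_mod_cast hr
    nlinarith [sq_nonneg ((r : ℝ) - 1)]
  set A := Matrix.diagonal (fun i => (c i)⁻¹) * U * Matrix.diagonal c with hA
  have hnorm : ‖(r : ℂ) / ((r : ℂ) ^ 2 + 1)‖ = a := by
    have : (r : ℂ) / ((r : ℂ) ^ 2 + 1) = (a : ℂ) := by
      rw [ha]
      push_cast
      rfl
    rw [this, Complex.norm_of_nonneg ha0]
  have hAapply : ∀ i j, A i j = (c i)⁻¹ * U i j * c j := fun i j => by
    rw [hA, Matrix.mul_diagonal, Matrix.diagonal_mul]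
  have hdiag : ∀ i, A i i = 1 := fun i => by
    rw [hAapply, hU, Matrix.submatrix_apply, dualPolarParameterMatrix, Matrix.of_apply,
      if_pos rfl, mul_one, inv_mul_cancel₀ (pow_ne_zero _ hr0)]
  have hoff : ∀ i j, i ≠ j → ‖A i j‖ =
      if ((f i : ℕ) = f j + 1 ∨ (f j : ℕ) = f i + 1) then a else 0 := by
    intro i j hij
    have hfij : f i ≠ f j := fun he => hij (hf he)
    rw [hAapply, hU, Matrix.submatrix_apply, dualPolarParameterMatrix, Matrix.of_apply,
      if_neg hfij]
    by_cases h1 : (f i : ℕ) = f j + 1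
    · rw [if_pos h1, if_pos (Or.inl h1), ← hnorm, ← norm_neg]
      congr 1
      simp only [hc, h1]
      push_cast
      field_simp
      ring
    · rw [if_neg h1]
      by_cases h2 : (f j : ℕ) = f i + 1
      · rw [if_pos h2, if_pos (Or.inr h2), ← hnorm, ← norm_neg]
        congr 1
        simp only [hc, h2]
        push_cast
        rw [_root_.zpow_neg, show (2 : ℤ) = ((2 : ℕ) : ℤ) from rfl, zpow_natCast]
        field_simp
        ring
      · rw [if_neg h2, if_neg (by tauto)]
        simp
  have hdet : A.det ≠ 0 := by
    refine det_ne_zero_of_sum_row_lt_diag fun k => ?_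
    rw [hdiag, norm_one]
    refine lt_of_le_of_lt ?_ ha1
    rw [Finset.sum_congr rfl fun j hj => hoff k j (Finset.ne_of_mem_erase hj).symm,
      ← Finset.sum_filter, Finset.sum_const, nsmul_eq_mul]
    refine mul_le_mul_of_nonneg_right ?_ ha0
    have h1 := card_adjacent_fin_le (Finset.univ.map ⟨f, hf⟩) (f k)
    rw [Finset.filter_map, Finset.card_map] at h1
    have h2 : ((Finset.univ.erase k).filter fun j =>
        (f k : ℕ) = f j + 1 ∨ (f j : ℕ) = f k + 1).card ≤ 2 :=
      le_trans (Finset.card_le_card (Finset.filter_subset_filter _ (Finset.erase_subset _ _))) h1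
    exact_mod_cast h2
  intro h0
  refine hdet ?_
  rw [hA, Matrix.det_mul, Matrix.det_mul, h0, mul_zero, zero_mul]

theorem isParameterMatrix_dualPolarParameterMatrix (hr : 1 < r) (D : ℕ) :
    IsParameterMatrix (dualPolarParameterMatrix (-(r : ℤ)) D) where
  tridiagonal i j hij := by
    rw [dualPolarParameterMatrix, Matrix.of_apply, if_neg (by rintro rfl; omega),
      if_neg (by omega), if_neg (by omega)]
  diag i := by simp [dualPolarParameterMatrix]
  offDiag := Or.inl fun i h2 hi => by
    have hr0 : (r : ℂ) ≠ 0 := Nat.cast_ne_zero.2 (by omega)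
    have hr1 : ((r : ℂ) ^ 2 + 1) ≠ 0 := by exact_mod_cast (by positivity : r ^ 2 + 1 ≠ 0)
    rw [entryFromOne_dualPolarParameterMatrix_pred _ h2 hi]
    simp [hr0, hr1]
  nonsingular s t _ := det_dualPolarParameterMatrix_submatrix_ne_zero hr Subtype.val_injective

end ParameterMatrix

/-! ### Transfer to the dual polar graph and to the graph without flat edges. -/

namespace IsotropicSubspace

open SimpleGraph

variable {K V : Type*} [Field K] [AddCommGroup V] [Module K V]
  {σ : K →+* K} {h : V →ₛₗ[σ] V →ₗ[K] K} {D r : ℕ}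

/-- The codimension of `y ∩ x` in `y`. -/
def rank (x y : IsotropicSubspace h D) : ℕ := D - Module.finrank K (x.meet y)

theorem rank_self (x : IsotropicSubspace h D) : x.rank x = 0 := by
  rw [rank, meet_self, x.finrank_eq, Nat.sub_self]

theorem rank_le (x y : IsotropicSubspace h D) : x.rank y ≤ D := Nat.sub_le _ _

variable [FiniteDimensional K V] {x : IsotropicSubspace h D}

theorem finrank_meet_le (x y : IsotropicSubspace h D) : Module.finrank K (x.meet y) ≤ D :=
  (Submodule.finrank_mono (x.meet_le_left y)).trans_eq y.finrank_eq

theorem isLower_iff {z y : IsotropicSubspace h D} :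
    x.IsLower z y ↔ (dualPolarGraph h D).Adj z y ∧ x.rank y = x.rank z + 1 := by
  have := x.finrank_meet_le y
  have := x.finrank_meet_le z
  unfold IsLower rank
  refine and_congr_right fun _ => ?_
  omega

theorem rank_le_of_adj (x : IsotropicSubspace h D) (y z : IsotropicSubspace h D)
    (hyz : (dualPolarGraph h D).Adj y z) : x.rank z ≤ x.rank y + 1 := by
  have := finrank_meet_le_of_adj (x := x) hyz
  unfold rank
  omega

variable [Finite K]

theorem exists_adj_rank_succ (H : IsFiniteHermitian h D r) (x y : IsotropicSubspace h D)
    (hyx : y ≠ x) : ∃ z, (dualPolarGraph h D).Adj z y ∧ x.rank y = x.rank z + 1 := by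
  obtain ⟨v, hvx, hvy⟩ : ∃ v ∈ x.carrier, v ∉ x.meet y := by
    by_contra! hcon
    exact hyx (eq_of_carrier_le ((show x.carrier ≤ x.meet y from hcon).trans
      (x.meet_le_left y))).symm
  obtain ⟨z, hzy, -⟩ := exists_isLower H x y (U := x.meet y ⊔ (K ∙ v))
    (sup_le (x.meet_le_right y) ((Submodule.span_singleton_le_iff_mem v _).2 hvx)) le_sup_left
    (Submodule.finrank_sup_span_singleton hvy)
  exact ⟨z, isLower_iff.1 hzy⟩

theorem exists_rank_eq (H : IsFiniteHermitian h D r) (x : IsotropicSubspace h D) (k : ℕ)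
    (hk : k ≤ D) : ∃ y, x.rank y = k := by
  classical
  induction k with
  | zero => exact ⟨x, x.rank_self⟩
  | succ k ih =>
    obtain ⟨z, hz⟩ := ih (by omega)
    -- As long as $z\cap x\ne0$, the formula for the number of upper neighbours is positive, so
    -- every rank up to $D$ occurs.
    have hpos : 0 < (Finset.univ.filter fun y => x.IsLower z y).card := by
      rw [card_upper H x z (n := k) (by have := x.finrank_meet_le z; unfold rank at hz; omega)]
      have := H.one_lt
      refine Nat.mul_pos (Finset.sum_pos (fun i _ => by positivity) ?_) (by positivity)
      rw [Finset.nonempty_range_iff]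
      have := x.finrank_meet_le z
      unfold rank at hz
      omega
    obtain ⟨y, hy⟩ := Finset.card_pos.1 hpos
    simp only [Finset.mem_filter, Finset.mem_univ, true_and] at hy
    exact ⟨y, by rw [(isLower_iff.1 hy).2, hz]⟩

theorem dualPolarGraph_connected (H : IsFiniteHermitian h D r) (x : IsotropicSubspace h D) :
    (dualPolarGraph h D).Connected :=
  connected_of_rank x.rank_self (x.exists_adj_rank_succ H)

theorem dualPolarGraph_dist (H : IsFiniteHermitian h D r) (x y : IsotropicSubspace h D) :
    (dualPolarGraph h D).dist x y = x.rank y :=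
  dist_eq_of_rank x.rank_self x.rank_le_of_adj (x.exists_adj_rank_succ H) y

theorem dualPolarGraph_eccent (H : IsFiniteHermitian h D r) (x : IsotropicSubspace h D) :
    (dualPolarGraph h D).eccent x = D := by
  refine (dualPolarGraph_connected H x).eccent_eq_of_dist (fun y => ?_) ?_
  · rw [dualPolarGraph_dist H]
    exact x.rank_le y
  · obtain ⟨y, hy⟩ := x.exists_rank_eq H D le_rfl
    exact ⟨y, (dualPolarGraph_dist H x y).trans hy⟩

theorem exists_adj_rank_succ_flatDeleted (H : IsFiniteHermitian h D r)
    (x y : IsotropicSubspace h D) (hyx : y ≠ x) :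
    ∃ z, ((dualPolarGraph h D).flatDeleted x).Adj z y ∧ x.rank y = x.rank z + 1 := by
  obtain ⟨z, hzy, hz⟩ := x.exists_adj_rank_succ H y hyx
  refine ⟨z, ⟨hzy, ?_⟩, hz⟩
  rw [dualPolarGraph_dist H, dualPolarGraph_dist H]
  omega

theorem flatDeleted_connected (H : IsFiniteHermitian h D r) (x : IsotropicSubspace h D) :
    ((dualPolarGraph h D).flatDeleted x).Connected :=
  connected_of_rank x.rank_self (x.exists_adj_rank_succ_flatDeleted H)

theorem flatDeleted_dist (H : IsFiniteHermitian h D r) (x y : IsotropicSubspace h D) :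
    ((dualPolarGraph h D).flatDeleted x).dist x y = x.rank y :=
  dist_eq_of_rank (G := (dualPolarGraph h D).flatDeleted x) x.rank_self
    (fun y z hyz => x.rank_le_of_adj y z hyz.1) (x.exists_adj_rank_succ_flatDeleted H) y

theorem flatDeleted_eccent (H : IsFiniteHermitian h D r) (x : IsotropicSubspace h D) :
    ((dualPolarGraph h D).flatDeleted x).eccent x = D := by
  refine (flatDeleted_connected H x).eccent_eq_of_dist (fun y => ?_) ?_
  · rw [flatDeleted_dist H]
    exact x.rank_le y
  · obtain ⟨y, hy⟩ := x.exists_rank_eq H D le_rfl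
    exact ⟨y, (flatDeleted_dist H x y).trans hy⟩

/-- Remaining edges change the distance from $x$ by exactly one, so its parity is a proper
2-colouring. -/
theorem flatDeleted_isBipartite (H : IsFiniteHermitian h D r) (x : IsotropicSubspace h D) :
    ((dualPolarGraph h D).flatDeleted x).IsBipartite := by
  refine ⟨Coloring.mk (fun y => (⟨x.rank y % 2, Nat.mod_lt _ two_pos⟩ : Fin 2)) ?_⟩
  intro y z hyz he
  have h1 := x.rank_le_of_adj y z hyz.1
  have h2 := x.rank_le_of_adj z y hyz.1.symm
  have h3 := hyz.2
  rw [dualPolarGraph_dist H, dualPolarGraph_dist H] at h3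
  rw [Fin.mk.injEq] at he
  omega

theorem dualPolarGraph_not_isBipartite (H : IsFiniteHermitian h D r) (hD : 1 ≤ D)
    (x : IsotropicSubspace h D) : ¬ (dualPolarGraph h D).IsBipartite := by
  rintro ⟨c⟩
  have hx := x.finrank_eq
  have hr := H.one_lt
  obtain ⟨C, hC⟩ : (hyperplanesBetween ⊥ x.carrier).Nonempty := by
    rw [← Finset.card_pos, card_hyperplanesBetween bot_le (n := D) (by simp [hx]), H.card_eq]
    exact Finset.sum_pos (fun i _ => by positivity) (Finset.nonempty_range_iff.2 (by omega))
  rw [mem_hyperplanesBetween, hx] at hC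
  have hcard := natCard_line H x hC.2.1 hC.2.2
  -- Since $r\ge2$, two further vertices pass through the hyperplane $C$ of $x$; together with $x$
  -- they form a triangle.
  have : Nontrivial {y : IsotropicSubspace h D // C ≤ y.carrier ∧ y ≠ x} := by
    rw [← Finite.one_lt_card_iff_nontrivial]
    omega
  obtain ⟨⟨y, hCy, hyx⟩, ⟨z, hCz, hzx⟩, hyz⟩ := exists_pair_ne
    {y : IsotropicSubspace h D // C ≤ y.carrier ∧ y ≠ x}
  have hyz' : y ≠ z := fun he => hyz (Subtype.ext he)
  have h1 := c.valid (adj_of_le hyx hC.2.2 hCy hC.2.1)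
  have h2 := c.valid (adj_of_le hzx hC.2.2 hCz hC.2.1)
  have h3 := c.valid (adj_of_le hyz' hC.2.2 hCy hCz)
  omega

/-- The lowering matrix of a graph depends only on its edges between consecutive distances
from `x`. -/
theorem loweringMatrix_eq_lowerMat {G : SimpleGraph (IsotropicSubspace h D)}
    (he : G.eccent x = D) (hd : ∀ y, G.dist x y = x.rank y)
    (hadj : ∀ z y, x.rank y = x.rank z + 1 → (G.Adj z y ↔ (dualPolarGraph h D).Adj z y)) :
    G.loweringMatrix x = lowerMat x := by
  rw [loweringMatrix_eq he fun y => (hd y).trans_le (x.rank_le y)]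
  ext z y
  have hiff : (G.Adj z y ∧ G.dist x y = G.dist x z + 1) ↔ x.IsLower z y := by
    rw [hd, hd, isLower_iff]
    exact and_congr_left fun hzy => hadj z y hzy
  simp only [lowerMat, Matrix.of_apply]
  classical
  exact ite_congr (propext hiff) (fun _ => rfl) (fun _ => rfl)

theorem raisingMatrix_eq_lowerMat_transpose {G : SimpleGraph (IsotropicSubspace h D)}
    (he : G.eccent x = D) (hd : ∀ y, G.dist x y = x.rank y)
    (hadj : ∀ z y, x.rank y = x.rank z + 1 → (G.Adj z y ↔ (dualPolarGraph h D).Adj z y)) :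
    G.raisingMatrix x = (lowerMat x)ᵀ := by
  rw [raisingMatrix_eq he fun y => (hd y).trans_le (x.rank_le y)]
  ext z y
  have hiff : (G.Adj z y ∧ G.dist x z = G.dist x y + 1) ↔ x.IsLower y z := by
    rw [hd, hd, isLower_iff, G.adj_comm]
    exact and_congr_left fun hzy => hadj y z hzy
  simp only [lowerMat, Matrix.transpose_apply, Matrix.of_apply]
  classical
  exact ite_congr (propext hiff) (fun _ => rfl) (fun _ => rfl)

theorem lowerMat_uniform (H : IsFiniteHermitian h D r) (x : IsotropicSubspace h D) {q : ℤ}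
    (hq : q = -(r : ℤ)) :
    (-((q : ℂ) ^ 4 / ((q : ℂ) ^ 2 + 1))) • ((lowerMat x)ᵀ * (lowerMat x * lowerMat x)) +
      lowerMat x * (lowerMat x)ᵀ * lowerMat x +
      (-((q : ℂ) ^ (-2 : ℤ) / ((q : ℂ) ^ 2 + 1))) • (lowerMat x * lowerMat x * (lowerMat x)ᵀ) =
    ((-(q : ℂ)) ^ (2 * D - 1)) • lowerMat x := by
  have hrel := lowerMat_relation H x
  have hr1 : ((r : ℂ) ^ 2 + 1) ≠ 0 := by exact_mod_cast (by positivity : r ^ 2 + 1 ≠ 0)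
  have hqr : (q : ℂ) = -(r : ℂ) := by rw [hq]; push_cast; rfl
  have hz : (-(r : ℂ)) ^ (-2 : ℤ) = ((r : ℂ) ^ 2)⁻¹ := by
    rw [_root_.zpow_neg, show (2 : ℤ) = ((2 : ℕ) : ℤ) from rfl, zpow_natCast, neg_sq]
  rw [hqr, hz, neg_neg, neg_sq, Even.neg_pow (by decide : Even 4)]
  have h2 := congrArg (((r : ℂ) ^ 2 + 1)⁻¹ • ·) hrel
  simp only [smul_add, smul_sub, smul_smul, inv_mul_cancel₀ hr1, inv_mul_cancel_left₀ hr1,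
    one_smul] at h2
  rw [← h2, sub_eq_add_neg, ← neg_smul]
  congr 3 <;> ring

/-- The coefficients are prescribed only where they matter: $L^2$ kills $E_1^*V$ and $R$ kills
$E_D^*V$. This covers both the constant coefficients used for $\Gamma$ and the convention
$e_1^-=e_D^+=0$ used for $\Gamma_f$. -/
theorem uniformEquationOn (H : IsFiniteHermitian h D r) {q : ℤ} (hq : q = -(r : ℤ))
    {G : SimpleGraph (IsotropicSubspace h D)}
    (he : G.eccent x = D) (hd : ∀ y, G.dist x y = x.rank y)
    (hadj : ∀ z y, x.rank y = x.rank z + 1 → (G.Adj z y ↔ (dualPolarGraph h D).Adj z y))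
    {i : ℕ} {em ep : ℂ} (hem : 2 ≤ i → em = -((q : ℂ) ^ 4 / ((q : ℂ) ^ 2 + 1)))
    (hep : i + 1 ≤ D → ep = -((q : ℂ) ^ (-2 : ℤ) / ((q : ℂ) ^ 2 + 1))) :
    G.UniformEquationOn x i em ep ((-(q : ℂ)) ^ (2 * D - 1)) := by
  intro v hv
  rw [loweringMatrix_eq_lowerMat he hd hadj, raisingMatrix_eq_lowerMat_transpose he hd hadj,
    ← lowerMat_uniform H x hq]
  simp only [Matrix.add_mulVec, Matrix.smul_mulVec]
  congr 1
  · congr 1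
    by_cases hi : 2 ≤ i
    · rw [hem hi]
    · rw [← Matrix.mulVec_mulVec,
        mulVec_eq_zero_of_mem_subconstituent hv (M := lowerMat x * lowerMat x)]
      · simp
      · intro z y hy
        rw [hd] at hy
        refine Finset.sum_eq_zero fun w _ => ?_
        simp only [lowerMat, Matrix.of_apply]
        by_cases hzw : x.IsLower z w
        · rw [if_neg (c := x.IsLower w y), mul_zero]
          intro hwy
          have h1 := (isLower_iff.1 hzw).2
          have h2 := (isLower_iff.1 hwy).2
          omega
        · rw [if_neg hzw, zero_mul]
  · by_cases hi : i + 1 ≤ D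
    · rw [hep hi]
    · rw [← Matrix.mulVec_mulVec, mulVec_eq_zero_of_mem_subconstituent hv (M := (lowerMat x)ᵀ)]
      · simp
      · intro z y hy
        rw [hd] at hy
        have := x.rank_le z
        simp only [lowerMat, Matrix.transpose_apply, Matrix.of_apply]
        refine if_neg fun hyz => ?_
        have := (isLower_iff.1 hyz).2
        omega

theorem flatDeleted_isStronglyUniformStructure (H : IsFiniteHermitian h D r)
    (x : IsotropicSubspace h D) {q : ℤ} (hq : q = -(r : ℤ)) :
    ((dualPolarGraph h D).flatDeleted x).IsStronglyUniformStructure x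
      (dualPolarParameterMatrix q D) (fun _ => (-(q : ℂ)) ^ (2 * D - 1)) where
  connected := flatDeleted_connected H x
  bipartite := flatDeleted_isBipartite H x
  eccent_eq := flatDeleted_eccent H x
  isParameterMatrix := hq ▸ isParameterMatrix_dualPolarParameterMatrix H.one_lt D
  equation i := uniformEquationOn H hq (flatDeleted_eccent H x) (flatDeleted_dist H x)
    (fun z y hzy => by
      refine and_iff_left ?_
      rw [dualPolarGraph_dist H, dualPolarGraph_dist H]
      omega)
    (fun h2 => eMinus_dualPolarParameterMatrix q h2 (by omega))
    (fun h2 => ePlus_dualPolarParameterMatrix q (by omega) h2)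
  eMinus_ne_zero i h2 hi := by
    have hr0 : (r : ℂ) ≠ 0 := Nat.cast_ne_zero.2 (by have := H.one_lt; omega)
    have hr1 : ((r : ℂ) ^ 2 + 1) ≠ 0 := by exact_mod_cast (by positivity : r ^ 2 + 1 ≠ 0)
    rw [eMinus_dualPolarParameterMatrix q h2 hi, hq]
    simp [hr0, hr1]
  ePlus_ne_zero i h1 hi := by
    have hr0 : (r : ℂ) ≠ 0 := Nat.cast_ne_zero.2 (by have := H.one_lt; omega)
    have hr1 : ((r : ℂ) ^ 2 + 1) ≠ 0 := by exact_mod_cast (by positivity : r ^ 2 + 1 ≠ 0)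
    rw [ePlus_dualPolarParameterMatrix q h1 hi, hq]
    simp [hr0, hr1, _root_.zpow_neg]

end IsotropicSubspace

end

theorem theorem8p4
    {K V : Type*} [Field K] [Fintype K] [AddCommGroup V] [Module K V] [FiniteDimensional K V]
    (D : ℕ) (hD : 3 ≤ D)
    -- `r = -q`, the field `K` has `r ^ 2` elements (so `r` is a prime power, and `q ≤ -2`)
    (q : ℤ) (r : ℕ) (hqr : q = -(r : ℤ)) (hK : Fintype.card K = r ^ 2)
    (hV : Module.finrank K V = 2 * D)
    -- `h` is a nondegenerate Hermitian form with respect to the involution `a ↦ a ^ r`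
    (σ : K →+* K) (hσ : ∀ a : K, σ a = a ^ r)
    (h : V →ₛₗ[σ] V →ₗ[K] K) (hherm : ∀ u v : V, h v u = σ (h u v)) (hnd : h.Nondegenerate)
    (x : IsotropicSubspace h D) :
    -- the identity on `E*_i V` for `1 ≤ i ≤ D`
    (∀ i : ℕ, 1 ≤ i → i ≤ D → (dualPolarGraph h D).UniformEquationOn x i
      (-((q : ℂ) ^ 4 / ((q : ℂ) ^ 2 + 1))) (-((q : ℂ) ^ (-2 : ℤ) / ((q : ℂ) ^ 2 + 1)))
      ((-(q : ℂ)) ^ (2 * D - 1))) ∧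
    -- the eccentricity of `x` is `D`, the matrix is a parameter matrix, and together with the
    -- constant vector it is a strongly uniform structure supported by the graph
    (dualPolarGraph h D).eccent x = D ∧
    SimpleGraph.IsParameterMatrix (dualPolarParameterMatrix q D) ∧
    (dualPolarGraph h D).SupportsStronglyUniformWith x
      (dualPolarParameterMatrix q D) (fun _ => (-(q : ℂ)) ^ (2 * D - 1)) := by
  have H : IsFiniteHermitian h D r :=
    ⟨by rw [Nat.card_eq_fintype_card, hK], hV, hσ, hherm, hnd⟩
  refine ⟨fun i _ _ => ?_, IsotropicSubspace.dualPolarGraph_eccent H x,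
    hqr ▸ isParameterMatrix_dualPolarParameterMatrix H.one_lt D,
    IsotropicSubspace.dualPolarGraph_connected H x,
    IsotropicSubspace.dualPolarGraph_not_isBipartite H (by omega) x,
    IsotropicSubspace.flatDeleted_isStronglyUniformStructure H x hqr⟩
  exact IsotropicSubspace.uniformEquationOn H hqr (IsotropicSubspace.dualPolarGraph_eccent H x)
    (IsotropicSubspace.dualPolarGraph_dist H x) (fun _ _ _ => Iff.rfl) (fun _ => rfl)
    (fun _ => rfl)
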